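/- **Setting.** Consider hard-core particles (occupations $n_s\in\{0,1\}$) on the sites of the infinite honeycomb lattice with sublattices $A,B$, and put $\varepsilon_s=+1$ on $A$, $\varepsilon_s=-1$ on $B$. A *ground state at filling $2/3$* is a configuration with exactly two particles on every hexagonal plaquette. *Cells and tiles.* Work on a finer lattice of hexagonal cells with centres $x e_1+y e_2$, $(x,y)\in\mathbb Z^2$, where $e_1,e_2$ are unit vectors at $60^\circ$. The tiles are the translates of $T_1=\{0,e_1,e_2\}$, $T_2=-T_1$ (set $\Sigma_1$) and of the three-in-line tiles $T_3=\{0,e_1,2e_1\}$, $T_4=\{0,e_2,2e_2\}$, $T_5=\{0,e_1-e_2,2(e_1-e_2)\}$ (set $\Sigma_2$). Plaquette $(i,j)$ is the hexagon of the 19 cells at distance at most $2$ from the cell $(3i-2j,\,2i+5j)$. Each site is then a corner common to three cells, one from each of its three plaquettes. The *particle tile* of a site consists of these three cells (it is a $T_1$ at an $A$ site and a $T_2$ at a $B$ site); the *hole tile* consists of these and the three further cells adjacent to two of them (a triangle of six cells). For a configuration $n$, the tile of a site is its particle tile if it is occupied and its hole tile otherwise, and the *middle region* of a plaquette is what its 19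 cells leave outside the tiles of its six sites. *Boundary invariant.* A finite set $C$ of cells is *simply connected* if $C$ is nonempty and connected and its complement is connected. An *oriented boundary* of $C$ is a closed path that runs exactly once, with $C$ on its left, along every side separating a cell of $C$ from a cell outside $C$. Shrinking the sides that face $\pm(e_1-e_2)$ turns the path into one with unit steps right ($A$), left ($A^{-1}$), up ($U$), down ($U^{-1}$); multiplying the letters met on the left gives a word in the free group $F=\langle A,U\rangle$. Let $H$ be the normal closure of $A^3,U^3,(U^{-1}A)^3$. The Cayley graph of $F/H$ is drawn as the kagome lattice, $A$-arrows running counterclockwise around the upward triangles and $U$-arrows clockwise around the downward triangles. For a word in $H$, which traces a closed path, $\varphi$ denotes the total counterclockwise winding number of that path around the hexagonal faces. $\varphi([\partial C])$ is the value of $\varphi$ on an oriented boundary of $C$; we call it *well defined* if an oriented boundary exists and all of them have words in $H$ with the same value of $\varphi$. *Regions.* For a finite set $R$ of plaquettes let $\hat R_n$ be the union of the middle regions of the plaquettes in $R$ and the tiles of all sites of these plaquettes, and write $\varphi([\partial R])=\varphi([\partial\hat R_n])$. Let $S_1$, $S_2$ be the sets of sites lying on exactly one, respectively exactly two, plaquettes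 of $R$; let $(N_A-N_B)_R=\sum_s\varepsilon_s n_s$ over all sites of plaquettes of $R$; let $\varphi_i$ be $\varphi$ of the boundary of the tile of site $i$, and let $\varphi_{i,M}$ be $\varphi$ of the boundary of the particle tile of $i$ if $i$ is occupied and $0$ otherwise. **Statement.** 1. For every ground state $n$ there is a tiling of the plane by translates of $T_1,\dots,T_5$ which contains the particle tile of each occupied site and which restricts to a tiling of the tile of each site and of the middle region of each plaquette. 2. If a finite set $R$ of plaquettes is nonempty and connected, and the plaquettes outside $R$ are connected to each other through shared sites that do not lie on plaquettes of $R$, then $\hat R_n$ is simply connected for every configuration $n$. 3. Let $n$ be a ground state. The invariants $\varphi$ of all site tiles and particle tiles are well defined. For every finite set $R$ of plaquettes for which $\hat R_n$ is simply connected, $\varphi([\partial R])$ is well defined and $$\tfrac12 (N_A-N_B)_R=\varphi([\partial R])-\tfrac23\sum_{i\in S_1}\bigl(\varphi_i-\tfrac12\varphi_{i,M}\bigr)-\tfrac13\sum_{i\in S_2}\bigl(\varphi_i-\tfrac12\varphi_{i,M}\bigr).$$ If $n'$ is another ground state that agrees with $n$ on $S_1\cup S_2$, then $\hat R_{n'}=\hat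 R_n$ and $(N_A-N_B)_R$ is the same for $n$ and $n'$. 4. If two ground states differ only on a finite set $\Lambda$ of sites, then $N_A-N_B$ on $\Lambda$ is the same for both: the total $\tilde N=N_A-N_B$ does not change. 5. Let $O$ be any operator with finite support $S$ (an arbitrary matrix on the occupations of the sites in $S$, tensored with the identity elsewhere) and let $P$ be the projection onto the span of the ground states. Then, on finite superpositions of configurations, $POP$ commutes with the operator $N_A-N_B$ of every finite set of sites $\Lambda\supseteq S$. Thus local operators acting within the constrained Hilbert space conserve $\tilde N=N_A-N_B$. -/

import Mathlib

open scoped BigOperators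

/-! ## The cell lattice

Cells of a hexagonal lattice are written in skew coordinates `(x, y) = x e₁ + y e₂`, where `e₁`, `e₂`
are unit vectors at an angle of 60 degrees.  The six neighbours of a cell are listed
counterclockwise.  A directed edge `(c, d)` is the side of the hexagon `c` that faces the neighbour
`c + dir d`, traversed with `c` on its left. -/

abbrev Cell : Type := ℤ × ℤ

def dir : Fin 6 → ℤ × ℤ :=
  ![(1, 0), (0, 1), (-1, 1), (-1, 0), (0, -1), (1, -1)]

def cellGraph : SimpleGraph Cell :=
  SimpleGraph.fromRel fun c c' => ∃ d : Fin 6, c' = c + dir d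

/-- A finite set of cells is simply connected: it is nonempty and connected, and so is its
complement in the plane. -/
def IsSimplyConnectedRegion (C : Finset Cell) : Prop :=
  (cellGraph.induce (C : Set Cell)).Connected ∧ (cellGraph.induce (C : Set Cell)ᶜ).Connected

abbrev DirectedEdge : Type := Cell × Fin 6

/-- A corner shared by three cells is recorded by the sum of the three cells (three times its
position). This is the corner at which the directed edge starts. -/
def DirectedEdge.source (δ : DirectedEdge) : ℤ × ℤ :=
  3 • δ.1 + dir (δ.2 - 1) + dir δ.2

/-- The corner at which the directed edge ends. -/
def DirectedEdge.target (δ : DirectedEdge) : ℤ × ℤ :=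
  3 • δ.1 + dir δ.2 + dir (δ.2 + 1)

/-- `γ` is an oriented boundary of `C`, with some base point: a closed path of directed edges which
runs exactly once through every side that separates a cell of `C` from a cell outside `C`,
keeping `C` on its left (counterclockwise). -/
def IsOrientedBoundary (γ : List DirectedEdge) (C : Finset Cell) : Prop :=
  γ ≠ [] ∧ γ.Nodup ∧
  (∀ δ : DirectedEdge, δ ∈ γ ↔ δ.1 ∈ C ∧ δ.1 + dir δ.2 ∉ C) ∧
  γ.map DirectedEdge.target = (γ.map DirectedEdge.source).rotate 1

/-! ## Boundary words and the winding invariant -/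

/-- The two generators: one step to the right, one step up. -/
inductive Gen : Type
  | A
  | U
deriving DecidableEq

abbrev genA : FreeGroup Gen := FreeGroup.of Gen.A

abbrev genU : FreeGroup Gen := FreeGroup.of Gen.U

/-- The letter of a directed edge. Shrinking the sides that face `±(e₁ - e₂)` to points turns the
hexagons into unit squares; the other sides become unit steps right, up, left or down. -/
def edgeLetter (δ : DirectedEdge) : FreeGroup Gen :=
  ![genU, genA⁻¹, 1, genU⁻¹, genA, 1] δ.2

/-- The boundary word; the letters met along the path are multiplied on the left. -/
def boundaryWord (γ : List DirectedEdge) : FreeGroup Gen :=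
  (γ.map edgeLetter).reverse.prod

/-- The normal closure `H` of `A³`, `U³`, `(U⁻¹A)³` in the free group. -/
def kagomeSubgroup : Subgroup (FreeGroup Gen) :=
  Subgroup.normalClosure {genA ^ 3, genU ^ 3, (genU⁻¹ * genA) ^ 3}

/-! The Cayley graph of the quotient by `H` is drawn as the kagome lattice. Its vertices are the
points `(x, y)` of a triangular lattice (skew coordinates as above) for which `x`, `y` are not both
even; the points `(2i, 2j)` are the centres of its hexagons. The arrows of the generator `A`
circulate counterclockwise around the upward triangles, those of `U` clockwise around the downward
triangles. (Both maps fix the points `(2i, 2j)`, which are not vertices.) -/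

def stepA (v : ℤ × ℤ) : ℤ × ℤ :=
  if v.1 % 2 = 1 then (if v.2 % 2 = 1 then (v.1 + 1, v.2) else (v.1, v.2 - 1))
  else (if v.2 % 2 = 1 then (v.1 - 1, v.2 + 1) else v)

def stepU (v : ℤ × ℤ) : ℤ × ℤ :=
  if v.1 % 2 = 1 then (if v.2 % 2 = 1 then (v.1, v.2 - 1) else (v.1 - 1, v.2 + 1))
  else (if v.2 % 2 = 1 then (v.1 + 1, v.2) else v)

theorem stepA_cube (v : ℤ × ℤ) : stepA (stepA (stepA v)) = v := by
  obtain ⟨x, y⟩ := v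
  rcases Int.emod_two_eq_zero_or_one x with hx | hx <;>
    rcases Int.emod_two_eq_zero_or_one y with hy | hy <;>
    simp [stepA, hx, hy, Int.add_emod, Int.sub_emod]

theorem stepU_cube (v : ℤ × ℤ) : stepU (stepU (stepU v)) = v := by
  obtain ⟨x, y⟩ := v
  rcases Int.emod_two_eq_zero_or_one x with hx | hx <;>
    rcases Int.emod_two_eq_zero_or_one y with hy | hy <;>
    simp [stepU, hx, hy, Int.add_emod, Int.sub_emod]

/-- Moving along the arrow of a generator, as a permutation. -/
def genPerm : Gen → Equiv.Perm (ℤ × ℤ)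
  | Gen.A => ⟨stepA, fun v => stepA (stepA v), stepA_cube, stepA_cube⟩
  | Gen.U => ⟨stepU, fun v => stepU (stepU v), stepU_cube, stepU_cube⟩

/-- The vertex of the drawn Cayley graph that belongs to a word; the identity is at `(1, 1)`. -/
def kagomeVertex (w : FreeGroup Gen) : ℤ × ℤ :=
  FreeGroup.lift genPerm w (1, 1)

/-- Two words lead to the same vertex exactly when they agree in the quotient by `H`, so the drawn
graph is the Cayley graph of the quotient. -/
theorem kagomeVertex_eq_iff (w w' : FreeGroup Gen) :
    kagomeVertex w = kagomeVertex w' ↔ w'⁻¹ * w ∈ kagomeSubgroup := by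
  have hfix : ∀ h ∈ kagomeSubgroup, ∀ v : ℤ × ℤ, FreeGroup.lift genPerm h v = v := by
    intro h hh v
    have hle : kagomeSubgroup ≤ (FreeGroup.lift genPerm).ker := by
      apply Subgroup.normalClosure_le_normal
      have key : ∀ v : ℤ × ℤ, stepU (stepU (stepA (stepU (stepU (stepA (stepU (stepU
          (stepA v)))))))) = v := by
        rintro ⟨x, y⟩
        rcases Int.emod_two_eq_zero_or_one x with hx | hx <;>
          rcases Int.emod_two_eq_zero_or_one y with hy | hy <;>
          simp [stepA, stepU, hx, hy, Int.add_emod, Int.sub_emod]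
      intro g hg
      rcases hg with rfl | rfl | rfl <;> rw [SetLike.mem_coe, MonoidHom.mem_ker] <;> ext1 v
      · simpa [pow_succ, genPerm] using stepA_cube v
      · simpa [pow_succ, genPerm] using stepU_cube v
      · have h1 : ∀ v, (genPerm Gen.U)⁻¹ v = stepU (stepU v) := fun v => rfl
        have h2 : ∀ v, genPerm Gen.A v = stepA v := fun v => rfl
        simpa only [pow_succ, pow_zero, one_mul, map_mul, map_inv, FreeGroup.lift_apply_of,
          Equiv.Perm.mul_apply, h1, h2, Equiv.Perm.one_apply] using key v
    have h1 := MonoidHom.mem_ker.1 (hle hh)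
    rw [h1]; rfl
  have : kagomeSubgroup.Normal := Subgroup.normalClosure_normal
  constructor
  · intro hw
    let q : FreeGroup Gen →* FreeGroup Gen ⧸ kagomeSubgroup := QuotientGroup.mk' _
    obtain ⟨a, ha⟩ : ∃ a, a = q genA := ⟨_, rfl⟩
    obtain ⟨u, hu⟩ : ∃ u, u = q genU := ⟨_, rfl⟩
    have hrel : ∀ g ∈ ({genA ^ 3, genU ^ 3, (genU⁻¹ * genA) ^ 3} : Set (FreeGroup Gen)),
        q g = 1 := fun g hg => (QuotientGroup.eq_one_iff g).2 (Subgroup.subset_normalClosure hg)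
    have ra : a * a * a = 1 := by
      have := hrel (genA ^ 3) (by simp)
      simpa [pow_succ, ← ha] using this
    have ru : u * u * u = 1 := by
      have := hrel (genU ^ 3) (by simp)
      simpa [pow_succ, ← hu] using this
    have rua : u⁻¹ * a * (u⁻¹ * a) * (u⁻¹ * a) = 1 := by
      have := hrel ((genU⁻¹ * genA) ^ 3) (by simp)
      simpa [pow_succ, ← hu, ← ha] using this
    obtain ⟨X, hX⟩ : ∃ X, X = u * a := ⟨_, rfl⟩
    obtain ⟨Y, hY⟩ : ∃ Y, Y = u⁻¹ * a * a := ⟨_, rfl⟩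
    have ru' : u⁻¹ = u * u := inv_eq_of_mul_eq_one_left ru
    have ra' : a⁻¹ = a * a := inv_eq_of_mul_eq_one_left ra
    have hXY : X * Y = Y * X := by
      have e1 : X * Y = u * a * u⁻¹ * a⁻¹ := by rw [hX, hY, ra']; group
      have e2 : Y * X = u⁻¹ * a⁻¹ * u * a := by rw [hX, hY, ra']; group
      have e3 : u⁻¹ * a * u⁻¹ * a * u⁻¹ = a⁻¹ := by
        rw [eq_inv_iff_mul_eq_one, ← rua]; group
      have e4 : u * a * u⁻¹ * a * (u⁻¹ * a * u) = 1 := by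
        calc u * a * u⁻¹ * a * (u⁻¹ * a * u)
            = u * u * (u⁻¹ * a * u⁻¹ * a * u⁻¹) * a * u := by group
          _ = u * u * u := by rw [e3]; group
          _ = 1 := ru
      rw [e1, e2]
      have e5 : u * a * u⁻¹ * a = (u⁻¹ * a * u)⁻¹ := eq_inv_of_mul_eq_one_left e4
      calc u * a * u⁻¹ * a⁻¹ = (u * a * u⁻¹ * a) * a := by rw [ra']; group
        _ = u⁻¹ * a⁻¹ * u * a := by rw [e5]; group
    have z01 : ((0 : ℤ) = 1) = False := by simp
    have hXYz : ∀ i j : ℤ, X ^ i * Y ^ j = Y ^ j * X ^ i := fun i j =>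
      ((show Commute X Y from hXY).zpow_zpow i j).eq
    obtain ⟨σ, hσ⟩ : ∃ σ : ℤ × ℤ → FreeGroup Gen ⧸ kagomeSubgroup, ∀ v, σ v =
      (if v.1 % 2 = 1 then (if v.2 % 2 = 1 then 1 else u) else u * u) *
        (X ^ (v.1 / 2) * Y ^ (v.2 / 2)) := ⟨_, fun _ => rfl⟩
    have hA : ∀ v : ℤ × ℤ, (v.1 % 2 = 1 ∨ v.2 % 2 = 1) →
        ((stepA v).1 % 2 = 1 ∨ (stepA v).2 % 2 = 1) ∧ σ (stepA v) = a * σ v := by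
      rintro ⟨x, y⟩ hv
      rcases Int.emod_two_eq_zero_or_one x with hx | hx <;>
        rcases Int.emod_two_eq_zero_or_one y with hy | hy
      · simp [hx, hy] at hv
      · refine ⟨by simp [stepA, hx, hy]; omega, ?_⟩
        have p1 : (x - 1) % 2 = 1 := by omega
        have p2 : (y + 1) % 2 = 0 := by omega
        have p3 : (x - 1) / 2 = -1 + x / 2 := by omega
        have p4 : (y + 1) / 2 = 1 + y / 2 := by omega
        simp only [hσ, stepA, hx, hy, z01, if_true, if_false, one_mul, p1, p2, p3, p4, zpow_add, zpow_one, zpow_neg]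
        have c1 := hXYz (x / 2) 1
        rw [zpow_one] at c1
        calc u * (X⁻¹ * X ^ (x / 2) * (Y * Y ^ (y / 2)))
            = u * X⁻¹ * (X ^ (x / 2) * Y) * Y ^ (y / 2) := by group
          _ = (u * X⁻¹ * Y) * (X ^ (x / 2) * Y ^ (y / 2)) := by rw [c1]; group
          _ = a * (u * u * (X ^ (x / 2) * Y ^ (y / 2))) := by
            have : u * X⁻¹ * Y = a * (u * u) := by
              rw [hX, hY, ← ru', mul_inv_rev, ra']
              have h1 : u⁻¹ * u⁻¹ = u := by rw [← mul_inv_rev, ← ru', inv_inv]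
              have h2 : a⁻¹ * (u * a⁻¹ * u * a⁻¹) * u = 1 := by
                rw [← inv_eq_one, ← rua]; group
              calc u * (a * a * u⁻¹) * (u⁻¹ * a * a)
                  = u * (a * a) * (u⁻¹ * u⁻¹) * (a * a) := by group
                _ = u * a⁻¹ * u * a⁻¹ := by rw [h1, ra']
                _ = a * (a⁻¹ * (u * a⁻¹ * u * a⁻¹) * u) * u⁻¹ := by group
                _ = a * u⁻¹ := by rw [h2, mul_one]
            rw [this]; group
      · refine ⟨by simp [stepA, hx, hy], ?_⟩
        have p2 : (y - 1) % 2 = 1 := by omega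
        have p4 : (y - 1) / 2 = -1 + y / 2 := by omega
        simp only [hσ, stepA, hx, hy, z01, if_true, if_false, one_mul, p2, p4, zpow_add, zpow_one, zpow_neg]
        have c1 := hXYz (x / 2) (-1)
        rw [zpow_neg_one] at c1
        have c2 : Y⁻¹ = a * u := by
          rw [hY, mul_inv_rev, mul_inv_rev, inv_inv, ra', mul_assoc, ← mul_assoc, ← mul_assoc]
          calc a * a * (a * a) * u = a * a * a * a * u := by group
            _ = a * u := by rw [ra, one_mul]
        rw [← mul_assoc, c1, c2]; group
      · refine ⟨by simp [stepA, hx, hy], ?_⟩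
        have p1 : (x + 1) % 2 = 0 := by omega
        have p3 : (x + 1) / 2 = 1 + x / 2 := by omega
        simp only [hσ, stepA, hx, hy, z01, if_true, if_false, one_mul, p1, p3, zpow_add, zpow_one]
        have c2 : u * u * X = a := by rw [hX, ← mul_assoc, ru, one_mul]
        rw [← mul_assoc, ← mul_assoc, c2, mul_assoc]
    have hU : ∀ v : ℤ × ℤ, (v.1 % 2 = 1 ∨ v.2 % 2 = 1) →
        ((stepU v).1 % 2 = 1 ∨ (stepU v).2 % 2 = 1) ∧ σ (stepU v) = u * σ v := by
      rintro ⟨x, y⟩ hv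
      rcases Int.emod_two_eq_zero_or_one x with hx | hx <;>
        rcases Int.emod_two_eq_zero_or_one y with hy | hy
      · simp [hx, hy] at hv
      · refine ⟨by simp [stepU, hx, hy], ?_⟩
        have p1 : (x + 1) % 2 = 1 := by omega
        have p3 : (x + 1) / 2 = x / 2 := by omega
        simp only [hσ, stepU, hx, hy, z01, if_true, if_false, one_mul, p1, p3]
        rw [← mul_assoc u (u * u), ← mul_assoc u u, ru, one_mul]
      · refine ⟨by simp [stepU, hx, hy]; omega, ?_⟩
        have p1 : (x - 1) % 2 = 0 := by omega
        have p2 : (y + 1) % 2 = 1 := by omega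
        have p3 : (x - 1) / 2 = x / 2 := by omega
        have p4 : (y + 1) / 2 = y / 2 := by omega
        simp only [hσ, stepU, hx, hy, z01, if_true, if_false, one_mul, p1, p2, p3, p4]
        rw [mul_assoc]
      · refine ⟨by simp [stepU, hx, hy], ?_⟩
        have p2 : (y - 1) % 2 = 0 := by omega
        have p4 : (y - 1) / 2 = y / 2 := by omega
        simp only [hσ, stepU, hx, hy, z01, if_true, if_false, one_mul, p2, p4]
    have hgen : ∀ (x : Gen) (v : ℤ × ℤ), (v.1 % 2 = 1 ∨ v.2 % 2 = 1) →
        ((genPerm x v).1 % 2 = 1 ∨ (genPerm x v).2 % 2 = 1) ∧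
          σ (genPerm x v) = q (FreeGroup.of x) * σ v := by
      intro x v hv
      cases x
      · simpa [genPerm, ha] using hA v hv
      · simpa [genPerm, hu] using hU v hv
    have hinv : ∀ (x : Gen) (v : ℤ × ℤ), (genPerm x)⁻¹ v = genPerm x (genPerm x v) := by
      intro x v; cases x <;> rfl
    have hall : ∀ (g : FreeGroup Gen) (v : ℤ × ℤ), (v.1 % 2 = 1 ∨ v.2 % 2 = 1) →
        ((FreeGroup.lift genPerm g v).1 % 2 = 1 ∨ (FreeGroup.lift genPerm g v).2 % 2 = 1) ∧
          σ (FreeGroup.lift genPerm g v) = q g * σ v := by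
      intro g
      induction g using FreeGroup.induction_on with
      | C1 => intro v hv; simpa using hv
      | of x => intro v hv; simpa using hgen x v hv
      | inv_of x _ =>
        intro v hv
        have k : ((genPerm x)⁻¹ v).1 % 2 = 1 ∨ ((genPerm x)⁻¹ v).2 % 2 = 1 := by
          rw [hinv]; exact (hgen x _ (hgen x v hv).1).1
        have k2 := (hgen x _ k).2
        rw [show genPerm x ((genPerm x)⁻¹ v) = v from (genPerm x).apply_symm_apply v] at k2
        rw [map_inv, FreeGroup.lift_apply_of, map_inv]
        exact ⟨k, by rw [k2]; group⟩
      | mul x y hx hy =>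
        intro v hv
        rw [map_mul, Equiv.Perm.mul_apply, map_mul]
        have k := hy v hv
        have k2 := hx _ k.1
        exact ⟨k2.1, by rw [k2.2, k.2, mul_assoc]⟩
    have f1 := (hall w (1, 1) (by simp)).2
    have f2 := (hall w' (1, 1) (by simp)).2
    have f3 : q w * σ (1, 1) = q w' * σ (1, 1) := by
      rw [← f1, ← f2]; exact congrArg σ hw
    exact QuotientGroup.eq.1 (mul_right_cancel f3).symm
  · intro hw
    have h1 := hfix _ hw (1, 1)
    rw [map_mul, map_inv, Equiv.Perm.mul_apply, Equiv.Perm.inv_eq_iff_eq] at h1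
    exact h1

/-- The path from the identity in the drawn Cayley graph that a word describes, the letters being
read from right to left. -/
def kagomePath (w : FreeGroup Gen) : List (ℤ × ℤ) :=
  (w.toWord.tails.map fun L => kagomeVertex (FreeGroup.mk L)).reverse

/-- The signed crossing of the edge from `v` to `v'` with the horizontal ray that starts at
`(2i, 2j + 1/2)`, a point of the hexagon centred at `(2i, 2j)`, and goes to the right: `1` upwards,
`-1` downwards. -/
def rayCrossing (i j : ℤ) (v v' : ℤ × ℤ) : ℤ :=
  if v.2 = 2 * j ∧ v'.2 = 2 * j + 1 ∧ 2 * i < v.1 then 1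
  else if v'.2 = 2 * j ∧ v.2 = 2 * j + 1 ∧ 2 * i < v'.1 then -1
  else 0

/-- The winding number of a closed path around the hexagon centred at `(2i, 2j)`. -/
def hexagonWinding (i j : ℤ) (P : List (ℤ × ℤ)) : ℤ :=
  (List.zipWith (rayCrossing i j) P P.tail).sum

/-- The winding invariant of a word in `H`: the total winding number of its closed path around the
hexagons of the kagome lattice, counted counterclockwise. -/
noncomputable def windingInvariant (w : FreeGroup Gen) : ℤ :=
  ∑ᶠ h : ℤ × ℤ, hexagonWinding h.1 h.2 (kagomePath w)

/-- `φ([∂C])`: the winding invariant of an oriented boundary of `C`. -/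
noncomputable def boundaryInvariant (C : Finset Cell) : ℤ :=
  open Classical in
  if h : ∃ γ, IsOrientedBoundary γ C then windingInvariant (boundaryWord h.choose) else 0

/-- `φ([∂C])` is well defined: `C` has an oriented boundary, and every oriented boundary of `C` gives
a word in `H` and the same winding invariant. -/
def HasBoundaryInvariant (C : Finset Cell) : Prop :=
  (∃ γ, IsOrientedBoundary γ C) ∧
  ∀ γ, IsOrientedBoundary γ C →
    boundaryWord γ ∈ kagomeSubgroup ∧ windingInvariant (boundaryWord γ) = boundaryInvariant C

/-! ## Tiles -/

/-- The triangular tiles `T₁`, `T₂`. -/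
def tileSet₁ : Finset (Finset Cell) :=
  {{(0, 0), (1, 0), (0, 1)}, {(0, 0), (-1, 0), (0, -1)}}

/-- The three-in-line tiles `T₃`, `T₄`, `T₅`. -/
def tileSet₂ : Finset (Finset Cell) :=
  {{(0, 0), (1, 0), (2, 0)}, {(0, 0), (0, 1), (0, 2)}, {(0, 0), (1, -1), (2, -2)}}

def translateCells (c : Cell) (T : Finset Cell) : Finset Cell :=
  T.image fun x => c + x

def IsTile (t : Finset Cell) : Prop :=
  ∃ c : Cell, ∃ T ∈ tileSet₁ ∪ tileSet₂, t = translateCells c T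

/-- `𝒯` is a tiling of the set of cells `X` by translates of the five tiles. -/
def IsTiling (𝒯 : Set (Finset Cell)) (X : Set Cell) : Prop :=
  (∀ t ∈ 𝒯, IsTile t) ∧ 𝒯.PairwiseDisjoint id ∧ ⋃ t ∈ 𝒯, (t : Set Cell) = X

/-! ## The physical honeycomb lattice

Plaquettes are indexed by `ℤ × ℤ` in the same kind of skew coordinates. The site `(A, p)` is the
common corner of the plaquettes `p`, `p + (1, 0)`, `p + (0, 1)`, the site `(B, p)` that of
`p`, `p - (1, 0)`, `p - (0, 1)`. -/

abbrev Plaquette : Type := ℤ × ℤ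

inductive Sublat : Type
  | A
  | B
deriving DecidableEq

abbrev Site : Type := Sublat × ℤ × ℤ

def plaquetteSites (p : Plaquette) : Finset Site :=
  {(Sublat.A, p), (Sublat.A, p - (1, 0)), (Sublat.A, p - (0, 1)),
   (Sublat.B, p), (Sublat.B, p + (1, 0)), (Sublat.B, p + (0, 1))}

/-- Hard-core configurations: each site is occupied (`true`) or empty (`false`). -/
abbrev Config : Type := Site → Bool

/-- The cluster-charging ground states at filling `2/3`: every plaquette carries two particles. -/
def IsGroundState (n : Config) : Prop :=
  ∀ p : Plaquette, ((plaquetteSites p).filter fun s => n s = true).card = 2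

def sublatticeSign (s : Site) : ℤ :=
  match s.1 with
  | Sublat.A => 1
  | Sublat.B => -1

/-- `N_A - N_B` on a finite set of sites. -/
def polarization (Λ : Finset Site) (n : Config) : ℤ :=
  ∑ s ∈ Λ, if n s = true then sublatticeSign s else 0

/-! ## From configurations to tilings

Each plaquette is drawn as the hexagon of the 19 cells at distance at most two from its centre; these
hexagons fill the plane. -/

def plaquetteCentre (p : Plaquette) : Cell :=
  (3 * p.1 - 2 * p.2, 2 * p.1 + 5 * p.2)

def plaquetteCells (p : Plaquette) : Finset Cell :=
  translateCells (plaquetteCentre p)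
    (insert (0, 0) (Finset.univ.biUnion fun d : Fin 6 =>
      {dir d, dir d + dir d, dir d + dir (d + 1)}))

/-- The (magenta) tile of a particle: the three cells around the site, a translate of `T₁` for an
`A` site and of `T₂` for a `B` site. -/
def particleTile (s : Site) : Finset Cell :=
  translateCells (plaquetteCentre s.2)
    (({(0, 2), (1, 2), (0, 3)} : Finset Cell).image fun x => sublatticeSign s • x)

/-- The (green) tile of a hole: the triangle of six cells around the site, of which the particle
tile is the middle part. -/
def holeTile (s : Site) : Finset Cell :=
  particleTile s ∪ translateCells (plaquetteCentre s.2)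
    (({(1, 1), (1, 3), (-1, 3)} : Finset Cell).image fun x => sublatticeSign s • x)

def siteTile (n : Config) (s : Site) : Finset Cell :=
  if n s = true then particleTile s else holeTile s

/-- The middle region of a plaquette, the space left by the tiles of its sites. -/
def middleRegion (n : Config) (p : Plaquette) : Finset Cell :=
  plaquetteCells p \ (plaquetteSites p).biUnion (siteTile n)

/-- The sites that belong to a plaquette of `R`. -/
def regionSites (R : Finset Plaquette) : Finset Site :=
  R.biUnion plaquetteSites

/-- The sites that belong to exactly `k` plaquettes of `R`; `S₁` and `S₂` for `k = 1, 2`. -/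
def sitesOfDegree (R : Finset Plaquette) (k : ℕ) : Finset Site :=
  (regionSites R).filter fun s => (R.filter fun p => s ∈ plaquetteSites p).card = k

/-- The tiled region of `R`: the middle regions of its plaquettes and the tiles of all its sites. -/
def tiledRegion (n : Config) (R : Finset Plaquette) : Finset Cell :=
  R.biUnion (middleRegion n) ∪ (regionSites R).biUnion (siteTile n)

/-- `φ_i`: the winding number of the tile at a site. -/
noncomputable def siteInvariant (n : Config) (s : Site) : ℤ :=
  boundaryInvariant (siteTile n s)

/-- `φ_{i,M}`: the winding number of the particle tile at a site, zero if there is no particle. -/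
noncomputable def particleInvariant (n : Config) (s : Site) : ℤ :=
  if n s = true then boundaryInvariant (particleTile s) else 0

/-- Plaquettes are joined when they share a site of `X`. -/
def plaquetteGraph (X : Set Site) : SimpleGraph Plaquette :=
  SimpleGraph.fromRel fun p q => ∃ s ∈ X, s ∈ plaquetteSites p ∧ s ∈ plaquetteSites q

/-- `R` together with its sites is simply connected: `R` is nonempty and connected, and the other
plaquettes are connected to each other through sites that do not belong to `R`. -/
def IsPlaquetteDisc (R : Finset Plaquette) : Prop :=
  ((plaquetteGraph Set.univ).induce (R : Set Plaquette)).Connected ∧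
  ((plaquetteGraph (regionSites R : Set Site)ᶜ).induce (R : Set Plaquette)ᶜ).Connected

/-! ## Local operators -/

/-- Finite superpositions of hard-core configurations of the infinite lattice. -/
abbrev StateSpace : Type := Config →₀ ℂ

/-- Replace the occupations on `S` by `m`. -/
def patch (S : Finset Site) (m : S → Bool) (n : Config) : Config :=
  fun s => if h : s ∈ S then m ⟨s, h⟩ else n s

/-- The operator with support in `S` that acts on the occupations in `S` by the matrix `X` and as the
identity elsewhere. -/
noncomputable def localOperator (S : Finset Site) (X : Matrix (S → Bool) (S → Bool) ℂ) :
    Module.End ℂ StateSpace :=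
  Finsupp.linearCombination ℂ fun n : Config =>
    ∑ m : S → Bool, Finsupp.single (patch S m n) (X m fun s => n s)

/-- The projection onto the constrained space, which the ground-state configurations span. -/
noncomputable def constraintProjection : Module.End ℂ StateSpace :=
  open Classical in
  Finsupp.linearCombination ℂ fun n : Config => if IsGroundState n then Finsupp.single n 1 else 0

/-- The operator `N_A - N_B` of a finite set of sites. -/
noncomputable def polarizationOperator (Λ : Finset Site) : Module.End ℂ StateSpace :=
  Finsupp.linearCombination ℂ fun n : Config => Finsupp.single n (polarization Λ n : ℂ)

/-! The argument is of Conway–Lagarias type. On `H` the winding invariant is an additive,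
conjugation-invariant function of words. To see this, let the free group act on kagome vertices
paired with an integer counter that records winding. Each of the three relators shifts the counter
by an amount independent of the starting vertex, so every element of `H` acts as a shift, and the
shift is the winding invariant (`countingAction_eq_windingInvariant`). Evaluating a word at one
vertex therefore decides membership in `H` and gives the invariant, which turns all local statements
into finite computations.

Additivity over tiles is a discrete Stokes theorem. The boundary word of each of the five tiles lies
in `H`, so the sides inside a tile can be relabelled until the word around every single cell lies in
`H`. Modulo `H` such a labelling is the gradient of a function on the corners. Correcting each label
by this function gives an element of `H`, hence an integer, for every side. In a sum over the cells
of a region the inner sides cancel and the boundary remains (`windingInvariant_boundaryWord`). In a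
tiled plane the invariant of a union of tiles is thus the number of `T₁` minus the number of `T₂`
(`exists_cell_weight`). Simple connectedness serves only to make the boundary one closed path.

The physical input is a table. With `ε` the sublattice sign and `n` the occupation, a site tile has
invariant `ε` if occupied and `-ε` if empty. The middle region of a plaquette with exactly two
particles can be tiled with invariant `-½ ∑ ε n` over its six sites (`midTiles_spec`). Since `∑ ε =
0` on a plaquette, the latter equals `-⅓ ∑ v` with `v = φ_i - ½ φ_{i,M} = (3/2) ε n - ε`, while `φ_i
= v + ½ ε n`. A site on `d` plaquettes of `R` contributes `½ ε n + (1 - d/3) v` to the invariant of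
the region, so interior sites, where `d = 3`, leave only half their imbalance. This is the formula
of `polarization_eq`.

All other terms of the formula depend only on the occupations on `S₁ ∪ S₂`, so these fix the
imbalance. Surrounding a finite set of sites by a large parallelogram gives the conservation law for
ground states, and with it the vanishing of the matrix elements of `POP` between different values of
the imbalance. -/

/-! ## The winding invariant as a homomorphism -/

/-- The points of the triangular lattice which are vertices of the kagome lattice. -/
def IsKagomeVertex (v : ℤ × ℤ) : Prop := v.1 % 2 = 1 ∨ v.2 % 2 = 1

/-- A potential for the total winding number: a step that crosses the line of height `2j + 1/2`
is weighted with the number of hexagons to its left, up to a constant. -/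
def rowWeight (v v' : ℤ × ℤ) : ℤ :=
  if v.2 % 2 = 0 ∧ v'.2 = v.2 + 1 then (v.1 + 1) / 2
  else if v'.2 % 2 = 0 ∧ v.2 = v'.2 + 1 then -((v'.1 + 1) / 2)
  else 0

theorem rowWeight_swap (v v' : ℤ × ℤ) : rowWeight v' v = -rowWeight v v' := by
  unfold rowWeight
  split_ifs <;> omega

/-- The action of a generator on the kagome lattice together with a winding counter. -/
def countingPerm (x : Gen) : Equiv.Perm ((ℤ × ℤ) × ℤ) where
  toFun p := (genPerm x p.1, p.2 + rowWeight p.1 (genPerm x p.1))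
  invFun p := ((genPerm x).symm p.1, p.2 - rowWeight ((genPerm x).symm p.1) p.1)
  left_inv p := by simp
  right_inv p := by simp

/-- The action of the free group on the kagome lattice together with a winding counter. -/
def countingAction : FreeGroup Gen →* Equiv.Perm ((ℤ × ℤ) × ℤ) := FreeGroup.lift countingPerm

theorem countingPerm_inv_apply (x : Gen) (p : (ℤ × ℤ) × ℤ) :
    (countingPerm x)⁻¹ p =
      ((genPerm x)⁻¹ p.1, p.2 + rowWeight p.1 ((genPerm x)⁻¹ p.1)) := by
  rw [rowWeight_swap, ← sub_eq_add_neg]; rfl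

theorem countingAction_fst (w : FreeGroup Gen) (p : (ℤ × ℤ) × ℤ) :
    (countingAction w p).1 = FreeGroup.lift genPerm w p.1 := by
  induction w using FreeGroup.induction_on generalizing p with
  | C1 => simp
  | of x => simp [countingAction, countingPerm]
  | inv_of x _ => simp [countingAction, countingPerm_inv_apply]
  | mul x y hx hy => simp [hx, hy]

/-- The increments of the counter depend only on the vertices visited, so the action commutes with
translations of the counter. -/
theorem countingAction_add (w : FreeGroup Gen) (v : ℤ × ℤ) (k m : ℤ) :
    countingAction w (v, k + m) =
      ((countingAction w (v, k)).1, (countingAction w (v, k)).2 + m) := by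
  induction w using FreeGroup.induction_on generalizing v k with
  | C1 => simp
  | of x => simp [countingAction, countingPerm, add_right_comm]
  | inv_of x _ => simp [countingAction, countingPerm_inv_apply, add_right_comm]
  | mul x y hx hy =>
    rw [map_mul, Equiv.Perm.mul_apply, hy, hx]
    rfl

theorem isKagomeVertex_genPerm (x : Gen) {v : ℤ × ℤ} (hv : IsKagomeVertex v) :
    IsKagomeVertex (genPerm x v) := by
  obtain ⟨a, b⟩ := v
  rcases Int.emod_two_eq_zero_or_one a with ha | ha <;>
    rcases Int.emod_two_eq_zero_or_one b with hb | hb <;> cases x <;>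
    simp [IsKagomeVertex, ha, hb] at hv <;>
    simp [IsKagomeVertex, genPerm, stepA, stepU, ha, hb, Int.add_emod, Int.sub_emod]

theorem isKagomeVertex_lift (w : FreeGroup Gen) {v : ℤ × ℤ} (hv : IsKagomeVertex v) :
    IsKagomeVertex (FreeGroup.lift genPerm w v) := by
  induction w using FreeGroup.induction_on generalizing v with
  | C1 => simpa
  | of x => simpa using isKagomeVertex_genPerm x hv
  | inv_of x _ =>
    have : ∀ u, (genPerm x)⁻¹ u = genPerm x (genPerm x u) := by intro u; cases x <;> rfl
    rw [map_inv, FreeGroup.lift_apply_of, this]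
    exact isKagomeVertex_genPerm x (isKagomeVertex_genPerm x hv)
  | mul x y hx hy =>
    rw [map_mul, Equiv.Perm.mul_apply]
    exact hx (hy hv)

/-- The words which act on the vertices of the kagome lattice by a shift of the counter. -/
def shiftSubgroup : Subgroup (FreeGroup Gen) where
  carrier := {w | ∃ m : ℤ, ∀ v, IsKagomeVertex v → ∀ k, countingAction w (v, k) = (v, k + m)}
  one_mem' := ⟨0, by simp⟩
  mul_mem' := by
    rintro a b ⟨m, hm⟩ ⟨l, hl⟩
    refine ⟨l + m, fun v hv k => ?_⟩
    rw [map_mul, Equiv.Perm.mul_apply, hl v hv, hm v hv, add_assoc]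
  inv_mem' := by
    rintro a ⟨m, hm⟩
    refine ⟨-m, fun v hv k => ?_⟩
    rw [map_inv, Equiv.Perm.inv_eq_iff_eq, hm v hv, neg_add_cancel_right]

theorem mem_shiftSubgroup {w : FreeGroup Gen} : w ∈ shiftSubgroup ↔
    ∃ m : ℤ, ∀ v, IsKagomeVertex v → ∀ k, countingAction w (v, k) = (v, k + m) := Iff.rfl

/-- The shift of `w` is the same at every kagome vertex, so moving to another vertex by `u⁻¹`,
shifting there and returning by `u` has the same effect. This gives both the normality of
`shiftSubgroup` and conjugation invariance. -/
theorem countingAction_conj {w : FreeGroup Gen} {m : ℤ}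
    (hm : ∀ v, IsKagomeVertex v → ∀ k, countingAction w (v, k) = (v, k + m)) (u : FreeGroup Gen)
    (v : ℤ × ℤ) (hv : IsKagomeVertex v) (k : ℤ) :
    countingAction (u * w * u⁻¹) (v, k) = (v, k + m) := by
  obtain ⟨p, hp⟩ : ∃ p, p = countingAction u⁻¹ (v, k) := ⟨_, rfl⟩
  have hg : IsKagomeVertex p.1 := by
    rw [hp, countingAction_fst]; exact isKagomeVertex_lift _ hv
  have hu : countingAction u p = (v, k) := by
    rw [hp, ← Equiv.Perm.mul_apply, ← map_mul, mul_inv_cancel, map_one]; rfl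
  rw [map_mul, map_mul, Equiv.Perm.mul_apply, Equiv.Perm.mul_apply, ← hp,
    show p = (p.1, p.2) from rfl, hm _ hg, countingAction_add, hu]

instance : shiftSubgroup.Normal :=
  ⟨fun w hw u => by
    obtain ⟨m, hm⟩ := mem_shiftSubgroup.1 hw
    exact mem_shiftSubgroup.2 ⟨m, countingAction_conj hm u⟩⟩

/-- Since `shiftSubgroup` is normal, only the three relators need checking, by the parities of the
starting vertex. -/
theorem kagomeSubgroup_le_shiftSubgroup : kagomeSubgroup ≤ shiftSubgroup := by
  apply Subgroup.normalClosure_le_normal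
  have h1 : ∀ p, countingAction genA p = (stepA p.1, p.2 + rowWeight p.1 (stepA p.1)) := by
    intro p; simp only [countingAction, FreeGroup.lift_apply_of]; rfl
  have h2 : ∀ p, countingAction genU p = (stepU p.1, p.2 + rowWeight p.1 (stepU p.1)) := by
    intro p; simp only [countingAction, FreeGroup.lift_apply_of]; rfl
  have h3 : ∀ p, (countingAction genU)⁻¹ p = (stepU (stepU p.1),
      p.2 + rowWeight p.1 (stepU (stepU p.1))) := by
    intro p
    simp only [countingAction, FreeGroup.lift_apply_of, countingPerm_inv_apply]; rfl
  intro g hg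
  rcases hg with rfl | rfl | rfl <;> rw [SetLike.mem_coe, mem_shiftSubgroup]
  · refine ⟨0, ?_⟩
    rintro ⟨x, y⟩ hv k
    simp only [pow_succ, pow_zero, one_mul, map_mul, Equiv.Perm.mul_apply, h1, stepA_cube]
    rcases Int.emod_two_eq_zero_or_one x with hx | hx <;>
      rcases Int.emod_two_eq_zero_or_one y with hy | hy <;>
      simp [stepA, rowWeight, hx, hy, Int.add_emod, Int.sub_emod] <;>
      (try split_ifs) <;> omega
  · refine ⟨0, ?_⟩
    rintro ⟨x, y⟩ hv k
    simp only [pow_succ, pow_zero, one_mul, map_mul, Equiv.Perm.mul_apply, h2, stepU_cube]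
    rcases Int.emod_two_eq_zero_or_one x with hx | hx <;>
      rcases Int.emod_two_eq_zero_or_one y with hy | hy <;>
      simp [stepU, rowWeight, hx, hy, Int.add_emod, Int.sub_emod]
  -- The powers `A³` and `U³` run around triangles and enclose no hexagon; `(U⁻¹A)³` runs once
  -- clockwise around a hexagon.
  · refine ⟨-1, ?_⟩
    rintro ⟨x, y⟩ hv k
    simp only [pow_succ, pow_zero, one_mul, map_mul, map_inv, Equiv.Perm.mul_apply, h1, h3]
    rcases Int.emod_two_eq_zero_or_one x with hx | hx <;>
      rcases Int.emod_two_eq_zero_or_one y with hy | hy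
    · simp [IsKagomeVertex, hx, hy] at hv
    all_goals
      simp [stepA, stepU, rowWeight, hx, hy, Int.add_emod, Int.sub_emod]
      omega

/-! The winding invariant of a closed path is the final value of the counter. -/

/-- The sum of a function of directed edges over the path of a list of letters. -/
def edgeSum (f : ℤ × ℤ → ℤ × ℤ → ℤ) : List (Gen × Bool) → ℤ
  | [] => 0
  | x :: L => edgeSum f L + f (kagomeVertex (FreeGroup.mk L)) (kagomeVertex (FreeGroup.mk (x :: L)))

theorem countingAction_mk (L : List (Gen × Bool)) :
    countingAction (FreeGroup.mk L) ((1, 1), 0) =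
      (kagomeVertex (FreeGroup.mk L), edgeSum rowWeight L) := by
  induction L with
  | nil => rfl
  | cons x L ih =>
    have e : FreeGroup.mk (x :: L) = FreeGroup.mk [x] * FreeGroup.mk L := by
      rw [FreeGroup.mul_mk]; rfl
    have e1 : countingAction (FreeGroup.mk (x :: L)) ((1, 1), 0) =
        countingAction (FreeGroup.mk [x]) (kagomeVertex (FreeGroup.mk L), edgeSum rowWeight L) := by
      rw [e, map_mul, Equiv.Perm.mul_apply, ih]
    have e2 : kagomeVertex (FreeGroup.mk (x :: L)) =
        FreeGroup.lift genPerm (FreeGroup.mk [x]) (kagomeVertex (FreeGroup.mk L)) := by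
      rw [kagomeVertex, e, map_mul, Equiv.Perm.mul_apply]; rfl
    rw [edgeSum, e1, e2]
    obtain ⟨x, b⟩ := x
    cases b
    · simp [countingAction, FreeGroup.lift_mk, countingPerm_inv_apply]
    · simp [countingAction, FreeGroup.lift_mk, countingPerm]

theorem sum_zipWith_tail_concat (f : ℤ × ℤ → ℤ × ℤ → ℤ) (P : List (ℤ × ℤ)) (v u : ℤ × ℤ) :
    (List.zipWith f (P ++ [v] ++ [u]) (P ++ [v] ++ [u]).tail).sum =
      (List.zipWith f (P ++ [v]) (P ++ [v]).tail).sum + f v u := by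
  induction P with
  | nil => simp
  | cons a P ih =>
    cases P with
    | nil => simp
    | cons b P =>
      simp only [List.cons_append, List.tail_cons, List.zipWith_cons_cons, List.sum_cons] at ih ⊢
      rw [add_assoc, ih]

theorem sum_zipWith_kagomePath (f : ℤ × ℤ → ℤ × ℤ → ℤ) (L : List (Gen × Bool)) :
    (List.zipWith f (L.tails.map fun L => kagomeVertex (FreeGroup.mk L)).reverse
      (L.tails.map fun L => kagomeVertex (FreeGroup.mk L)).reverse.tail).sum = edgeSum f L := by
  induction L with
  | nil => simp [edgeSum]
  | cons x L ih =>
    rw [edgeSum, ← ih]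
    have : ∃ T, (L.tails.map fun L => kagomeVertex (FreeGroup.mk L)).reverse =
        T ++ [kagomeVertex (FreeGroup.mk L)] := by
      cases L with
      | nil => exact ⟨[], rfl⟩
      | cons y L => simp
    obtain ⟨T, hT⟩ := this
    simp only [List.tails_cons, List.map_cons, List.reverse_cons]
    rw [hT]
    exact sum_zipWith_tail_concat f T _ _

/-- The signed crossings of the line of height `2j + 1/2`. -/
def lineCrossing (j : ℤ) (v v' : ℤ × ℤ) : ℤ :=
  if v.2 = 2 * j ∧ v'.2 = 2 * j + 1 then 1
  else if v'.2 = 2 * j ∧ v.2 = 2 * j + 1 then -1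
  else 0

theorem abs_kagomeVertex_cons (x : Gen × Bool) (L : List (Gen × Bool)) :
    ((kagomeVertex (FreeGroup.mk (x :: L))).1 - (kagomeVertex (FreeGroup.mk L)).1 ≤ 1 ∧
    -1 ≤ (kagomeVertex (FreeGroup.mk (x :: L))).1 - (kagomeVertex (FreeGroup.mk L)).1) ∧
    (kagomeVertex (FreeGroup.mk (x :: L))).2 - (kagomeVertex (FreeGroup.mk L)).2 ≤ 1 ∧
    -1 ≤ (kagomeVertex (FreeGroup.mk (x :: L))).2 - (kagomeVertex (FreeGroup.mk L)).2 := by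
  have e : FreeGroup.mk (x :: L) = FreeGroup.mk [x] * FreeGroup.mk L := by
    rw [FreeGroup.mul_mk]; rfl
  have e2 : kagomeVertex (FreeGroup.mk (x :: L)) =
      FreeGroup.lift genPerm (FreeGroup.mk [x]) (kagomeVertex (FreeGroup.mk L)) := by
    rw [kagomeVertex, e, map_mul, Equiv.Perm.mul_apply]; rfl
  rw [e2]
  generalize kagomeVertex (FreeGroup.mk L) = v
  obtain ⟨x, b⟩ := x
  have hinv : ∀ u, (genPerm x)⁻¹ u = genPerm x (genPerm x u) := by intro u; cases x <;> rfl
  obtain ⟨a, c⟩ := v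
  rcases Int.emod_two_eq_zero_or_one a with ha | ha <;>
    rcases Int.emod_two_eq_zero_or_one c with hc | hc <;> cases b <;> cases x <;>
    simp [FreeGroup.lift_mk, hinv] <;>
    simp [genPerm, stepA, stepU, ha, hc, Int.add_emod, Int.sub_emod] <;> omega

/-- The crossings telescope to whether the endpoint lies above the line, compared with the start
`(1, 1)`. A closed path therefore crosses each line zero times in total, which makes the additive
constant in `rowWeight` harmless. -/
theorem edgeSum_lineCrossing (j : ℤ) (L : List (Gen × Bool)) :
    edgeSum (lineCrossing j) L =
      (if 2 * j + 1 ≤ (kagomeVertex (FreeGroup.mk L)).2 then 1 else 0) -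
        (if 2 * j + 1 ≤ 1 then 1 else 0) := by
  induction L with
  | nil =>
    have : kagomeVertex (FreeGroup.mk []) = (1, 1) := rfl
    simp [edgeSum, this]
  | cons x L ih =>
    rw [edgeSum, ih]
    have h := abs_kagomeVertex_cons x L
    unfold lineCrossing
    split_ifs <;> omega

theorem abs_kagomeVertex_le (L : List (Gen × Bool)) :
    (kagomeVertex (FreeGroup.mk L)).1 ≤ 1 + L.length ∧
    1 - (L.length : ℤ) ≤ (kagomeVertex (FreeGroup.mk L)).1 ∧
    (kagomeVertex (FreeGroup.mk L)).2 ≤ 1 + L.length ∧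
    1 - (L.length : ℤ) ≤ (kagomeVertex (FreeGroup.mk L)).2 := by
  induction L with
  | nil =>
    have : kagomeVertex (FreeGroup.mk []) = (1, 1) := rfl
    simp [this]
  | cons x L ih =>
    have h := abs_kagomeVertex_cons x L
    simp only [List.length_cons, Nat.cast_add, Nat.cast_one]
    omega

/-- Two functions on directed edges which agree on edges in a box have the same sum over a path in
this box. -/
theorem edgeSum_congr {f g : ℤ × ℤ → ℤ × ℤ → ℤ} {N : ℤ} (L : List (Gen × Bool))
    (hL : (L.length : ℤ) < N)
    (h : ∀ v v' : ℤ × ℤ, (-N ≤ v.1 ∧ v.1 ≤ N ∧ -N ≤ v.2 ∧ v.2 ≤ N) →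
      (-N ≤ v'.1 ∧ v'.1 ≤ N ∧ -N ≤ v'.2 ∧ v'.2 ≤ N) →
      f v v' = g v v') : edgeSum f L = edgeSum g L := by
  induction L with
  | nil => rfl
  | cons x L ih =>
    have h1 := abs_kagomeVertex_le L
    have h2 := abs_kagomeVertex_le (x :: L)
    simp only [List.length_cons, Nat.cast_add, Nat.cast_one] at h2 hL
    rw [edgeSum, edgeSum, ih (by omega), h _ _ (by omega) (by omega)]

theorem edgeSum_sum {ι : Type*} (s : Finset ι) (f : ι → ℤ × ℤ → ℤ × ℤ → ℤ)
    (L : List (Gen × Bool)) :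
    ∑ i ∈ s, edgeSum (f i) L = edgeSum (fun v v' => ∑ i ∈ s, f i v v') L := by
  induction L with
  | nil => simp [edgeSum]
  | cons x L ih => simp only [edgeSum, Finset.sum_add_distrib, ih]

theorem edgeSum_add_mul (f g : ℤ × ℤ → ℤ × ℤ → ℤ) (c : ℤ) (L : List (Gen × Bool)) :
    edgeSum (fun v v' => f v v' + c * g v v') L = edgeSum f L + c * edgeSum g L := by
  induction L with
  | nil => simp [edgeSum]
  | cons x L ih => simp only [edgeSum, ih]; ring

theorem sum_Ico_ite_two_mul_lt {N x : ℤ} (h1 : -N ≤ x) (h2 : x ≤ N) :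
    ∑ i ∈ Finset.Ico (-N) (N + 1), (if 2 * i < x then (1 : ℤ) else 0) = (x + 1) / 2 + N := by
  rw [← Finset.sum_filter]
  have : (Finset.Ico (-N) (N + 1)).filter (fun i => 2 * i < x) = Finset.Ico (-N) ((x + 1) / 2) := by
    ext i; simp only [Finset.mem_filter, Finset.mem_Ico]; omega
  rw [this, Finset.sum_const, Int.card_Ico, nsmul_eq_mul, mul_one]
  omega

/-- A step across the line of height `2j + 1/2` crosses exactly the rays that start to its left.
Their number is `rowWeight` up to sign and the constant `N`, which appears as a multiple of
`lineCrossing`. -/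
theorem sum_Ico_rayCrossing {N : ℤ} (j : ℤ) (v v' : ℤ × ℤ) (hv : -N ≤ v.1 ∧ v.1 ≤ N)
    (hv' : -N ≤ v'.1 ∧ v'.1 ≤ N) :
    ∑ i ∈ Finset.Ico (-N) (N + 1), rayCrossing i j v v' =
      (if v.2 = 2 * j ∨ v'.2 = 2 * j then rowWeight v v' else 0) + N * lineCrossing j v v' := by
  by_cases h1 : v.2 = 2 * j ∧ v'.2 = 2 * j + 1
  · have : ∀ i, rayCrossing i j v v' = if 2 * i < v.1 then 1 else 0 := by
      intro i; unfold rayCrossing; split_ifs <;> omega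
    simp only [this, sum_Ico_ite_two_mul_lt hv.1 hv.2]
    unfold rowWeight lineCrossing; split_ifs <;> omega
  · by_cases h2 : v'.2 = 2 * j ∧ v.2 = 2 * j + 1
    · have : ∀ i, rayCrossing i j v v' = - if 2 * i < v'.1 then 1 else 0 := by
        intro i; unfold rayCrossing; split_ifs <;> omega
      simp only [this, Finset.sum_neg_distrib, sum_Ico_ite_two_mul_lt hv'.1 hv'.2]
      unfold rowWeight lineCrossing; split_ifs <;> omega
    · have : ∀ i, rayCrossing i j v v' = 0 := by
        intro i; unfold rayCrossing; split_ifs <;> omega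
      simp only [this, Finset.sum_const_zero]
      have h3 : lineCrossing j v v' = 0 := by rw [lineCrossing, if_neg h1, if_neg h2]
      rw [h3]
      unfold rowWeight; split_ifs <;> omega

theorem sum_Ico_row {N : ℤ} (v v' : ℤ × ℤ) (hv : -N ≤ v.2 ∧ v.2 ≤ N)
    (hv' : -N ≤ v'.2 ∧ v'.2 ≤ N) :
    ∑ j ∈ Finset.Ico (-N) (N + 1),
      (if v.2 = 2 * j ∨ v'.2 = 2 * j then rowWeight v v' else 0) = rowWeight v v' := by
  by_cases h : rowWeight v v' = 0
  · simp [h]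
  · have key : ∃ j, ∀ i, (v.2 = 2 * i ∨ v'.2 = 2 * i) ↔ i = j := by
      unfold rowWeight at h
      split_ifs at h with h1 h2
      · exact ⟨v.2 / 2, fun i => by omega⟩
      · exact ⟨v'.2 / 2, fun i => by omega⟩
      · exact absurd rfl h
    obtain ⟨j, hj⟩ := key
    simp only [hj]
    rw [Finset.sum_ite_eq', if_pos]
    have := (hj j).2 rfl
    rw [Finset.mem_Ico]; omega

/-- Interchanging the sums over hexagons and steps, the contributions of a step add up to its
`rowWeight`, because the multiples of `lineCrossing` vanish on a closed path. -/
theorem windingInvariant_eq_edgeSum {w : FreeGroup Gen} (hw : kagomeVertex w = (1, 1)) :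
    windingInvariant w = edgeSum rowWeight w.toWord := by
  obtain ⟨L, hL⟩ : ∃ L, L = w.toWord := ⟨_, rfl⟩
  have hv : kagomeVertex (FreeGroup.mk L) = (1, 1) := by rw [hL, FreeGroup.mk_toWord, hw]
  have h0 : ∀ h : ℤ × ℤ, hexagonWinding h.1 h.2 (kagomePath w) =
      edgeSum (rayCrossing h.1 h.2) L := by
    intro h
    rw [hexagonWinding, kagomePath, ← hL]
    exact sum_zipWith_kagomePath _ L
  have hz : ∀ j, edgeSum (lineCrossing j) L = 0 := by
    intro j; rw [edgeSum_lineCrossing, hv]; simp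
  obtain ⟨N, hN⟩ : ∃ N : ℤ, N = L.length + 1 := ⟨_, rfl⟩
  have hzero : ∀ f : ℤ × ℤ → ℤ × ℤ → ℤ, (∀ v v', f v v' = 0) → edgeSum f L = 0 := by
    intro f hf
    have : f = fun _ _ => 0 := by funext v v'; exact hf v v'
    rw [this]
    clear hL hv h0 hz hN
    induction L with
    | nil => rfl
    | cons x L ih => simp [edgeSum, ih]
  unfold windingInvariant
  simp only [h0]
  rw [finsum_eq_sum_of_support_subset
    (s := Finset.Ico (-N) (N + 1) ×ˢ Finset.Ico (-N) (N + 1)), Finset.sum_product, Finset.sum_comm,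
    ← hL]
  · have h1 : ∀ j, ∑ i ∈ Finset.Ico (-N) (N + 1), edgeSum (rayCrossing i j) L =
        edgeSum (fun v v' => if v.2 = 2 * j ∨ v'.2 = 2 * j then rowWeight v v' else 0) L := by
      intro j
      rw [edgeSum_sum, edgeSum_congr (N := N) L (by omega) (fun v v' hv hv' =>
        sum_Ico_rayCrossing j v v' ⟨hv.1, hv.2.1⟩ ⟨hv'.1, hv'.2.1⟩), edgeSum_add_mul, hz, mul_zero,
        add_zero]
    rw [Finset.sum_congr rfl fun j _ => h1 j, edgeSum_sum]
    exact edgeSum_congr (N := N) L (by omega) fun v v' hv hv' => sum_Ico_row v v' hv.2.2 hv'.2.2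
  · rintro ⟨i, j⟩ hij
    rw [Function.mem_support] at hij
    by_contra hout
    simp only [Finset.coe_product, Set.mem_prod, Finset.coe_Ico, Set.mem_Ico] at hout
    apply hij
    -- Hexagons outside the box contribute nothing: rays at a distant height or starting far to the
    -- right are never crossed, and a ray starting far to the left meets all crossings of its line,
    -- which cancel.
    by_cases hj : -N ≤ j ∧ j < N + 1
    · by_cases hi : N + 1 ≤ i
      · rw [edgeSum_congr (N := N) (g := fun _ _ => 0) L (by omega)]
        · exact hzero _ fun _ _ => rfl
        · intro v v' hv hv'
          simp only [rayCrossing]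
          split_ifs <;> omega
      · rw [edgeSum_congr (N := N) (g := lineCrossing j) L (by omega)]
        · exact hz j
        · intro v v' hv hv'
          simp only [rayCrossing, lineCrossing]
          split_ifs <;> omega
    · rw [edgeSum_congr (N := N) (g := fun _ _ => 0) L (by omega)]
      · exact hzero _ fun _ _ => rfl
      · intro v v' hv hv'
        simp only [rayCrossing]
        split_ifs <;> omega

theorem countingAction_eq_windingInvariant {w : FreeGroup Gen} (hw : w ∈ kagomeSubgroup)
    {v : ℤ × ℤ} (hv : IsKagomeVertex v) (k : ℤ) :
    countingAction w (v, k) = (v, k + windingInvariant w) := by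
  obtain ⟨m, hm⟩ := mem_shiftSubgroup.1 (kagomeSubgroup_le_shiftSubgroup hw)
  have h1 := hm (1, 1) (Or.inl rfl) 0
  have h2 := countingAction_mk w.toWord
  rw [FreeGroup.mk_toWord] at h2
  rw [h2, zero_add, Prod.mk.injEq] at h1
  rw [windingInvariant_eq_edgeSum h1.1, h1.2]
  exact hm v hv k

/-- A word that closes up at the single vertex `(1, 1)` lies in `H` because the drawn graph is the
Cayley graph of the quotient. This form makes membership in `H` and the value of the invariant
accessible to evaluation. -/
theorem windingInvariant_eq_of_countingAction {w : FreeGroup Gen} {m : ℤ}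
    (h : countingAction w ((1, 1), 0) = ((1, 1), m)) :
    w ∈ kagomeSubgroup ∧ windingInvariant w = m := by
  have h1 : w ∈ kagomeSubgroup := by
    have h2 := countingAction_fst w ((1, 1), 0)
    rw [h] at h2
    have := (kagomeVertex_eq_iff w 1).1 (by simpa [kagomeVertex] using h2.symm)
    simpa using this
  refine ⟨h1, ?_⟩
  have h3 := countingAction_eq_windingInvariant h1 (v := (1, 1)) (Or.inl rfl) 0
  rw [h, zero_add] at h3
  exact (congrArg Prod.snd h3).symm

/-! ### Additivity and conjugation invariance on `H` -/

theorem windingInvariant_mul {w w' : FreeGroup Gen} (hw : w ∈ kagomeSubgroup)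
    (hw' : w' ∈ kagomeSubgroup) :
    windingInvariant (w * w') = windingInvariant w + windingInvariant w' := by
  refine (windingInvariant_eq_of_countingAction ?_).2
  rw [map_mul, Equiv.Perm.mul_apply, countingAction_eq_windingInvariant hw' (Or.inl rfl),
    countingAction_eq_windingInvariant hw (Or.inl rfl), zero_add, add_comm]

theorem windingInvariant_one : windingInvariant 1 = 0 :=
  (windingInvariant_eq_of_countingAction (by simp)).2

theorem windingInvariant_inv {w : FreeGroup Gen} (hw : w ∈ kagomeSubgroup) :
    windingInvariant w⁻¹ = -windingInvariant w := by
  have := windingInvariant_mul (inv_mem hw) hw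
  rw [inv_mul_cancel, windingInvariant_one] at this
  omega

theorem windingInvariant_conj {w : FreeGroup Gen} (hw : w ∈ kagomeSubgroup)
    (u : FreeGroup Gen) : windingInvariant (u * w * u⁻¹) = windingInvariant w := by
  refine (windingInvariant_eq_of_countingAction ?_).2
  rw [countingAction_conj (fun v hv k => countingAction_eq_windingInvariant hw hv k) u _
    (Or.inl rfl), zero_add]

/-! ## Labellings of the edges of the cell lattice -/

/-- The recursion is solved separately to the right and to the left of `0`, starting from the value
`1`. -/
theorem exists_int_potential {Q : Type*} [Group Q] (f : ℤ → Q) :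
    ∃ g : ℤ → Q, ∀ k, g (k + 1) = f k * g k := by
  let pos : ℕ → Q := fun k => Nat.rec 1 (fun k a => f k * a) k
  let neg : ℕ → Q := fun k => Nat.rec 1 (fun k a => (f (-(k + 1 : ℤ)))⁻¹ * a) k
  refine ⟨fun k => if 0 ≤ k then pos k.toNat else neg (-k).toNat, fun k => ?_⟩
  rcases lt_trichotomy k (-1) with hk | rfl | hk
  · obtain ⟨j, rfl⟩ : ∃ j : ℕ, k = -(j + 2 : ℤ) := ⟨(-k - 2).toNat, by omega⟩
    beta_reduce
    rw [if_neg (by omega), if_neg (by omega),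
      show (-(-(j + 2 : ℤ) + 1)).toNat = j + 1 by omega,
      show (-(-(j + 2 : ℤ))).toNat = j + 1 + 1 by omega]
    change neg (j + 1) = _ * ((f (-((j + 1 : ℕ) + 1 : ℤ)))⁻¹ * neg (j + 1))
    rw [show (-((j + 1 : ℕ) + 1 : ℤ)) = -(j + 2 : ℤ) by push_cast; ring, mul_inv_cancel_left]
  · change (1 : Q) = f (-1) * ((f (-(0 + 1)))⁻¹ * 1)
    simp
  · obtain ⟨j, rfl⟩ : ∃ j : ℕ, k = j := ⟨k.toNat, by omega⟩
    beta_reduce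
    rw [if_pos (by omega), if_pos (by omega), show ((j : ℤ) + 1).toNat = j + 1 by omega,
      Int.toNat_natCast]

/-- A closed form on the square lattice with values in a group is exact. -/
theorem exists_potential {Q : Type*} [Group Q] (X Y : ℤ → ℤ → Q)
    (h : ∀ x y, Y (x + 1) y * X x y = X x (y + 1) * Y x y) :
    ∃ g : ℤ → ℤ → Q, ∀ x y, g (x + 1) y = X x y * g x y ∧ g x (y + 1) = Y x y * g x y := by
  obtain ⟨a, ha⟩ := exists_int_potential fun x => X x 0
  choose b hb using fun x => exists_int_potential fun y => Y x y
  have hg : ∀ x y, b x (y + 1) * (b x 0)⁻¹ * a x = Y x y * (b x y * (b x 0)⁻¹ * a x) := by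
    intro x y; rw [hb]; group
  refine ⟨fun x y => b x y * (b x 0)⁻¹ * a x, fun x y => ⟨?_, hg x y⟩⟩
  -- The vertical relation holds by construction, and the horizontal one on the line `y = 0`; the
  -- closing condition carries the latter from row to row.
  induction y using Int.induction_on with
  | zero => simp [ha]
  | succ k ih =>
    simp only [hg, ih]
    rw [← mul_assoc, h, mul_assoc]
  | pred k ih =>
    have h1 := hg (x + 1) (-k - 1)
    have h2 := hg x (-k - 1)
    have h3 := h x (-k - 1)
    rw [sub_add_cancel] at h1 h2 h3
    simp only [h1, h2] at ih ⊢
    rw [← mul_assoc (X x (-k)), ← h3, mul_assoc (Y (x + 1) _) (X x _)] at ih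
    exact mul_left_cancel ih

theorem dir_add_three (d : Fin 6) : dir (d + 3) = -dir d := by
  revert d; decide

/-- The same side, traversed in the opposite direction. -/
def DirectedEdge.rev (δ : DirectedEdge) : DirectedEdge := (δ.1 + dir δ.2, δ.2 + 3)

theorem DirectedEdge.rev_rev (δ : DirectedEdge) : δ.rev.rev = δ := by
  obtain ⟨c, d⟩ := δ
  have : d + 3 + 3 = d := by revert d; decide
  simp [DirectedEdge.rev, dir_add_three, this]

theorem DirectedEdge.rev_ne (δ : DirectedEdge) : δ.rev ≠ δ := by
  obtain ⟨c, d⟩ := δ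
  intro h
  have := congrArg Prod.snd h
  revert this
  simp only [DirectedEdge.rev]
  clear h
  revert d; decide

theorem DirectedEdge.source_rev (δ : DirectedEdge) : δ.rev.source = δ.target := by
  obtain ⟨⟨x, y⟩, d⟩ := δ
  revert d
  simp only [DirectedEdge.rev, DirectedEdge.source, DirectedEdge.target, Fin.forall_fin_succ,
    Fin.forall_fin_zero]
  simp [dir, Prod.ext_iff]
  omega

theorem DirectedEdge.target_rev (δ : DirectedEdge) : δ.rev.target = δ.source := by
  rw [← DirectedEdge.source_rev, DirectedEdge.rev_rev]

/-- The product of the labels met along a path, multiplied on the left. -/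
def pathWord {Q : Type*} [Group Q] (l : DirectedEdge → Q) (γ : List DirectedEdge) : Q :=
  (γ.map l).reverse.prod

/-- The sides of a cell, counterclockwise. -/
def cellEdges (c : Cell) : List DirectedEdge :=
  [(c, 0), (c, 1), (c, 2), (c, 3), (c, 4), (c, 5)]

/-- If the labels multiply to one around every cell, they are the increments of a function on the
corners. -/
theorem exists_corner_potential {Q : Type*} [Group Q] (l : DirectedEdge → Q)
    (hrev : ∀ δ, l δ.rev = (l δ)⁻¹) (hcell : ∀ c, pathWord l (cellEdges c) = 1) :
    ∃ g : ℤ × ℤ → Q, ∀ δ : DirectedEdge, g δ.target = l δ * g δ.source := by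
  have hr3 : ∀ x y, l ((x, y), 3) = (l ((x - 1, y), 0))⁻¹ := by
    intro x y; rw [← hrev]; simp [DirectedEdge.rev, dir]
  have hr4 : ∀ x y, l ((x, y), 4) = (l ((x, y - 1), 1))⁻¹ := by
    intro x y; rw [← hrev]; simp [DirectedEdge.rev, dir]
  have hr5 : ∀ x y, l ((x, y), 5) = (l ((x + 1, y - 1), 2))⁻¹ := by
    intro x y; rw [← hrev]; simp [DirectedEdge.rev, dir]
  have hc : ∀ x y, (l ((x + 1, y - 1), 2))⁻¹ * (l ((x, y - 1), 1))⁻¹ * (l ((x - 1, y), 0))⁻¹ *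
      l ((x, y), 2) * l ((x, y), 1) * l ((x, y), 0) = 1 := by
    intro x y
    rw [← hr3, ← hr4, ← hr5, ← hcell (x, y)]
    simp [pathWord, cellEdges, mul_assoc]
  -- The corners `(3x + 1, 3y + 1)` form a square lattice. A unit step between them takes two sides
  -- by way of a corner of the form `(3x' + 2, 3y' + 2)`, and the two ways around a unit square
  -- differ by the circuit of the cell `(x + 1, y + 1)`.
  obtain ⟨a, ha⟩ := exists_potential
    (fun x y => (l ((x + 1, y), 1))⁻¹ * (l ((x + 1, y), 2))⁻¹)
    (fun x y => l ((x, y + 1), 0) * (l ((x + 1, y), 2))⁻¹) (by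
      intro x y
      have := hc (x + 1) (y + 1)
      simp only [add_sub_cancel_right] at this
      rw [mul_assoc, mul_assoc, mul_assoc, mul_assoc] at this
      have h2 : l ((x + 1, y + 1), 2) * (l ((x + 1, y + 1), 1) * l ((x + 1, y + 1), 0)) =
        l ((x, y + 1), 0) * l ((x + 1, y), 1) * l ((x + 1 + 1, y), 2) := by
        rw [inv_mul_eq_one, eq_inv_mul_iff_mul_eq, eq_inv_mul_iff_mul_eq] at this
        rw [← this, mul_assoc]
      have h3 : l ((x + 1, y + 1), 0) = (l ((x + 1, y + 1), 1))⁻¹ * (l ((x + 1, y + 1), 2))⁻¹ *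
          (l ((x, y + 1), 0) * l ((x + 1, y), 1) * l ((x + 1 + 1, y), 2)) := by
        rw [← h2]; group
      rw [h3]; group)
  have hstep : ∀ x y, a (x + 1) (y - 1) =
      (l ((x + 1, y - 1), 1))⁻¹ * (l ((x, y), 0))⁻¹ * a x y := by
    intro x y
    have h1 := (ha x (y - 1)).1
    have h2 := (ha x (y - 1)).2
    rw [sub_add_cancel] at h2
    rw [h1, h2]; group
  -- The second branch is meant for the corners `(3x + 2, 3y + 2)`, each reached by one side from
  -- `(3x + 4, 3y + 1)`. Its values at points that are not corners play no role.
  refine ⟨fun v => if v.1 % 3 = 1 then a (v.1 / 3) (v.2 / 3)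
    else l ((v.1 / 3 + 1, v.2 / 3), 1) * a (v.1 / 3 + 1) (v.2 / 3), ?_⟩
  intro δ
  obtain ⟨g, hg⟩ : ∃ g : ℤ × ℤ → Q, g = fun v => if v.1 % 3 = 1 then a (v.1 / 3) (v.2 / 3)
    else l ((v.1 / 3 + 1, v.2 / 3), 1) * a (v.1 / 3 + 1) (v.2 / 3) := ⟨_, rfl⟩
  rw [← hg]
  have hα : ∀ x y, g (3 * x + 1, 3 * y + 1) = a x y := by
    intro x y
    rw [hg]
    simp only
    rw [if_pos (by omega), show (3 * x + 1) / 3 = x by omega, show (3 * y + 1) / 3 = y by omega]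
  have hβ : ∀ x y, g (3 * x + 2, 3 * y + 2) = l ((x + 1, y), 1) * a (x + 1) y := by
    intro x y
    rw [hg]
    simp only
    rw [if_neg (by omega), show (3 * x + 2) / 3 = x by omega, show (3 * y + 2) / 3 = y by omega]
  have h012 : ∀ c : Cell, ∀ d : Fin 6, d = 0 ∨ d = 1 ∨ d = 2 →
      g (DirectedEdge.target (c, d)) = l (c, d) * g (DirectedEdge.source (c, d)) := by
    rintro ⟨x, y⟩ d (rfl | rfl | rfl)
    · rw [show DirectedEdge.target ((x, y), 0) = (3 * x + 1, 3 * y + 1) by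
          simp [DirectedEdge.target, dir],
        show DirectedEdge.source ((x, y), 0) = (3 * x + 2, 3 * (y - 1) + 2) by
          simp [DirectedEdge.source, dir]; omega, hα, hβ, hstep]
      group
    · rw [show DirectedEdge.target ((x, y), 1) = (3 * (x - 1) + 2, 3 * y + 2) by
          simp [DirectedEdge.target, dir]; omega,
        show DirectedEdge.source ((x, y), 1) = (3 * x + 1, 3 * y + 1) by
          simp [DirectedEdge.source, dir], hα, hβ, sub_add_cancel]
    · rw [show DirectedEdge.target ((x, y), 2) = (3 * (x - 1) + 1, 3 * y + 1) by
          simp [DirectedEdge.target, dir]; omega,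
        show DirectedEdge.source ((x, y), 2) = (3 * (x - 1) + 2, 3 * y + 2) by
          simp [DirectedEdge.source, dir]; omega, hα, hβ]
      have := (ha (x - 1) y).1
      rw [sub_add_cancel] at this ⊢
      rw [this]; group
  by_cases hd : δ.2 = 0 ∨ δ.2 = 1 ∨ δ.2 = 2
  · exact h012 δ.1 δ.2 hd
  · have hd' : δ.rev.2 = 0 ∨ δ.rev.2 = 1 ∨ δ.rev.2 = 2 := by
      obtain ⟨c, d⟩ := δ
      simp only [DirectedEdge.rev] at hd ⊢
      revert d; decide
    have := h012 δ.rev.1 δ.rev.2 hd'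
    rw [Prod.mk.eta, DirectedEdge.source_rev, DirectedEdge.target_rev, hrev] at this
    rw [this, mul_inv_cancel_left]

/-! ### Stokes' theorem for labellings that are flat modulo `H` -/

/-- The path `γ` runs from the corner `v` to the corner `v'`. -/
def IsPathBetween : ℤ × ℤ → List DirectedEdge → ℤ × ℤ → Prop
  | v, [], v' => v = v'
  | v, δ :: γ, v' => δ.source = v ∧ IsPathBetween δ.target γ v'

theorem isPathBetween_of_map_target_eq (γ : List DirectedEdge) (δ : DirectedEdge) (v : ℤ × ℤ)
    (h : (δ :: γ).map DirectedEdge.target = γ.map DirectedEdge.source ++ [v]) :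
    IsPathBetween δ.source (δ :: γ) v := by
  induction γ generalizing δ with
  | nil => simpa [IsPathBetween] using h
  | cons ε γ ih =>
    simp only [List.map_cons, List.cons_append, List.cons.injEq] at h
    refine ⟨rfl, ?_⟩
    rw [h.1]
    exact ih ε (by simpa using h.2)

theorem isPathBetween_of_closed {γ : List DirectedEdge} (h0 : γ ≠ [])
    (h : γ.map DirectedEdge.target = (γ.map DirectedEdge.source).rotate 1) :
    ∃ v, IsPathBetween v γ v := by
  cases γ with
  | nil => exact absurd rfl h0
  | cons δ γ =>
    exact ⟨δ.source, isPathBetween_of_map_target_eq γ δ δ.source (by simpa using h)⟩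

theorem isPathBetween_cellEdges (c : Cell) : ∃ v, IsPathBetween v (cellEdges c) v := by
  obtain ⟨x, y⟩ := c
  apply isPathBetween_of_closed
  · simp [cellEdges]
  · simp [cellEdges, DirectedEdge.source, DirectedEdge.target, dir]

/-- Labels in the free group which multiply to elements of `H` around every cell. -/
structure IsFlatLabelling (l : DirectedEdge → FreeGroup Gen) : Prop where
  rev : ∀ δ, l δ.rev = (l δ)⁻¹
  cell : ∀ c, pathWord l (cellEdges c) ∈ kagomeSubgroup

/-- After correction by the corner function `g`, every single label lies in `H` and has an invariant
of its own. The factors `g` telescope along a path, and additivity on `H` turns the product into a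
sum. -/
theorem windingInvariant_pathWord {l : DirectedEdge → FreeGroup Gen} {g : ℤ × ℤ → FreeGroup Gen}
    (hg : ∀ δ : DirectedEdge, (g δ.target)⁻¹ * l δ * g δ.source ∈ kagomeSubgroup)
    (γ : List DirectedEdge) (v v' : ℤ × ℤ) (h : IsPathBetween v γ v') :
    (g v')⁻¹ * pathWord l γ * g v ∈ kagomeSubgroup ∧
    windingInvariant ((g v')⁻¹ * pathWord l γ * g v) =
      (γ.map fun δ => windingInvariant ((g δ.target)⁻¹ * l δ * g δ.source)).sum := by
  induction γ generalizing v with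
  | nil =>
    obtain rfl : v = v' := h
    simp [pathWord, windingInvariant_one]
  | cons δ γ ih =>
    obtain ⟨rfl, h2⟩ := h
    obtain ⟨i1, i2⟩ := ih _ h2
    have e : (g v')⁻¹ * pathWord l (δ :: γ) * g δ.source =
        ((g v')⁻¹ * pathWord l γ * g δ.target) * ((g δ.target)⁻¹ * l δ * g δ.source) := by
      simp only [pathWord, List.map_cons, List.reverse_cons, List.prod_append, List.prod_singleton]
      group
    rw [e]
    refine ⟨mul_mem i1 (hg δ), ?_⟩
    rw [windingInvariant_mul i1 (hg δ), i2, List.map_cons, List.sum_cons, add_comm]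

theorem windingInvariant_closed_pathWord {l : DirectedEdge → FreeGroup Gen}
    {g : ℤ × ℤ → FreeGroup Gen}
    (hg : ∀ δ : DirectedEdge, (g δ.target)⁻¹ * l δ * g δ.source ∈ kagomeSubgroup)
    {γ : List DirectedEdge} {v : ℤ × ℤ} (h : IsPathBetween v γ v) :
    pathWord l γ ∈ kagomeSubgroup ∧ windingInvariant (pathWord l γ) =
      (γ.map fun δ => windingInvariant ((g δ.target)⁻¹ * l δ * g δ.source)).sum := by
  obtain ⟨h1, h2⟩ := windingInvariant_pathWord hg γ v v h
  have hn : kagomeSubgroup.Normal := Subgroup.normalClosure_normal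
  have e : pathWord l γ = g v * ((g v)⁻¹ * pathWord l γ * g v) * (g v)⁻¹ := by group
  refine ⟨?_, ?_⟩
  · rw [e]; exact hn.conj_mem _ h1 _
  · rw [← h2, e, windingInvariant_conj h1]
    group

/-- The sides that separate a cell of `C` from a cell outside `C`. -/
def boundaryEdges (C : Finset Cell) : Finset DirectedEdge :=
  (C ×ˢ Finset.univ).filter fun δ => δ.1 + dir δ.2 ∉ C

theorem mem_boundaryEdges {C : Finset Cell} {δ : DirectedEdge} :
    δ ∈ boundaryEdges C ↔ δ.1 ∈ C ∧ δ.1 + dir δ.2 ∉ C := by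
  simp [boundaryEdges]

/-- A side between two cells of `C` occurs once in each direction; reversal pairs these off and they
cancel. -/
theorem sum_boundaryEdges (C : Finset Cell) (f : DirectedEdge → ℤ)
    (hf : ∀ δ, f δ.rev = -f δ) :
    ∑ δ ∈ boundaryEdges C, f δ = ∑ c ∈ C, ∑ d, f (c, d) := by
  rw [← Finset.sum_product', ← Finset.sum_filter_add_sum_filter_not (C ×ˢ Finset.univ)
    (fun δ : DirectedEdge => δ.1 + dir δ.2 ∉ C)]
  rw [boundaryEdges, left_eq_add]
  refine Finset.sum_involution (fun δ _ => DirectedEdge.rev δ) ?_ ?_ ?_ ?_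
  · intro δ _; rw [hf, add_neg_cancel]
  · intro δ _ _; exact DirectedEdge.rev_ne δ
  · intro δ hδ
    simp only [Finset.mem_filter, Finset.mem_product, Finset.mem_univ, and_true,
      not_not] at hδ ⊢
    simpa [DirectedEdge.rev, dir_add_three] using hδ.symm
  · intro δ _; exact DirectedEdge.rev_rev δ

/-- The winding invariant of a boundary is the sum of the contributions of the cells. -/
theorem windingInvariant_boundaryWord {l : DirectedEdge → FreeGroup Gen} (hl : IsFlatLabelling l)
    {C : Finset Cell} (hC : ∀ δ ∈ boundaryEdges C, l δ = edgeLetter δ) {γ : List DirectedEdge}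
    (hγ : IsOrientedBoundary γ C) :
    boundaryWord γ ∈ kagomeSubgroup ∧ windingInvariant (boundaryWord γ) =
      ∑ c ∈ C, windingInvariant (pathWord l (cellEdges c)) := by
  have hn : kagomeSubgroup.Normal := Subgroup.normalClosure_normal
  obtain ⟨gq, hgq⟩ := exists_corner_potential
    (fun δ => (QuotientGroup.mk' kagomeSubgroup) (l δ))
    (fun δ => by rw [hl.rev, map_inv]) (fun c => by
      rw [← (QuotientGroup.eq_one_iff _).2 (hl.cell c)]
      simp [pathWord, cellEdges])
  -- The potential exists only modulo `H`. Arbitrary representatives in the free group suffice,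
  -- because the corrected labels then still lie in `H`.
  obtain ⟨g, hg⟩ : ∃ g : ℤ × ℤ → FreeGroup Gen,
      ∀ δ : DirectedEdge, (g δ.target)⁻¹ * l δ * g δ.source ∈ kagomeSubgroup := by
    refine ⟨fun v => (gq v).out, fun δ => ?_⟩
    have h := hgq δ
    rw [← QuotientGroup.eq_one_iff]
    simp only [QuotientGroup.mk_mul, QuotientGroup.mk_inv, QuotientGroup.out_eq', h,
      QuotientGroup.mk'_apply]
    group
  obtain ⟨v, hv⟩ := isPathBetween_of_closed hγ.1 hγ.2.2.2
  have hmem : ∀ δ, δ ∈ γ ↔ δ ∈ boundaryEdges C := fun δ => by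
    rw [hγ.2.2.1, mem_boundaryEdges]
  have e : boundaryWord γ = pathWord l γ := by
    rw [boundaryWord, pathWord]
    congr 2
    exact List.map_congr_left fun δ hδ => (hC δ ((hmem δ).1 hδ)).symm
  obtain ⟨h1, h2⟩ := windingInvariant_closed_pathWord hg hv
  rw [e]
  refine ⟨h1, ?_⟩
  rw [h2, ← List.sum_toFinset _ hγ.2.1, show γ.toFinset = boundaryEdges C by
    ext δ; rw [List.mem_toFinset, hmem], sum_boundaryEdges]
  · refine Finset.sum_congr rfl fun c _ => ?_
    obtain ⟨u, hu⟩ := isPathBetween_cellEdges c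
    rw [(windingInvariant_closed_pathWord hg hu).2]
    simp [cellEdges, Fin.sum_univ_succ]
  · intro δ
    rw [DirectedEdge.source_rev, DirectedEdge.target_rev, hl.rev, ← windingInvariant_inv (hg δ)]
    congr 1
    group

/-! ## The boundary of a simply connected region is a single closed path -/

theorem DirectedEdge.target_eq_iff {δ ε : DirectedEdge} : ε.target = δ.target ↔
    ε = δ ∨ ε = (δ.1 + dir δ.2, δ.2 + 2) ∨ ε = (δ.1 + dir (δ.2 + 1), δ.2 + 4) := by
  obtain ⟨⟨x, y⟩, d⟩ := δ
  obtain ⟨⟨x', y'⟩, d'⟩ := ε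
  fin_cases d <;> fin_cases d' <;>
    simp [DirectedEdge.target, dir, Prod.ext_iff, Fin.ext_iff] <;> omega

theorem DirectedEdge.source_eq_target_iff {δ ε : DirectedEdge} : ε.source = δ.target ↔
    ε = DirectedEdge.rev δ ∨ ε = DirectedEdge.rev (δ.1 + dir δ.2, δ.2 + 2) ∨
      ε = DirectedEdge.rev (δ.1 + dir (δ.2 + 1), δ.2 + 4) := by
  have h : ∀ a : DirectedEdge, ε = DirectedEdge.rev a ↔ DirectedEdge.rev ε = a := fun a =>
    ⟨fun h => by rw [h, DirectedEdge.rev_rev], fun h => by rw [← h, DirectedEdge.rev_rev]⟩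
  rw [h, h, h, ← DirectedEdge.target_rev, DirectedEdge.target_eq_iff]

/-- The signed number of times a path runs through a side. -/
def edgeFlow (Γ : Finset DirectedEdge) (δ : DirectedEdge) : ℤ :=
  (if δ ∈ Γ then 1 else 0) - (if DirectedEdge.rev δ ∈ Γ then 1 else 0)

theorem edgeFlow_rev (Γ : Finset DirectedEdge) (δ : DirectedEdge) :
    edgeFlow Γ (DirectedEdge.rev δ) = -edgeFlow Γ δ := by
  rw [edgeFlow, DirectedEdge.rev_rev, edgeFlow, neg_sub]

/-- Conservation of flow at a corner: a closed path arrives at each corner as often as it leaves it,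
and exactly three sides, listed in `DirectedEdge.target_eq_iff`, end there. -/
theorem edgeFlow_corner {γ : List DirectedEdge} (hn : γ.Nodup)
    (hγ : γ.map DirectedEdge.target = (γ.map DirectedEdge.source).rotate 1) (δ : DirectedEdge) :
    edgeFlow γ.toFinset δ + edgeFlow γ.toFinset (δ.1 + dir δ.2, δ.2 + 2) +
      edgeFlow γ.toFinset (δ.1 + dir (δ.2 + 1), δ.2 + 4) = 0 := by
  obtain ⟨Γ, hΓ⟩ : ∃ Γ, Γ = γ.toFinset := ⟨_, rfl⟩
  rw [← hΓ]
  obtain ⟨δ₁, h₁⟩ : ∃ δ₁ : DirectedEdge, δ₁ = (δ.1 + dir δ.2, δ.2 + 2) := ⟨_, rfl⟩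
  obtain ⟨δ₂, h₂⟩ : ∃ δ₂ : DirectedEdge, δ₂ = (δ.1 + dir (δ.2 + 1), δ.2 + 4) := ⟨_, rfl⟩
  have hd : δ ≠ δ₁ ∧ δ ≠ δ₂ ∧ δ₁ ≠ δ₂ := by
    obtain ⟨c, d⟩ := δ
    have : d ≠ d + 2 ∧ d ≠ d + 4 ∧ d + 2 ≠ d + 4 := by
      clear h₁ h₂; revert d; decide
    rw [h₁, h₂]
    exact ⟨fun h => this.1 (congrArg Prod.snd h), fun h => this.2.1 (congrArg Prod.snd h),
      fun h => this.2.2 (congrArg Prod.snd h)⟩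
  have hsplit : ∀ (p : DirectedEdge → ℤ × ℤ) (a b c : DirectedEdge), a ≠ b → a ≠ c → b ≠ c →
      (∀ ε, p ε = δ.target ↔ ε = a ∨ ε = b ∨ ε = c) →
      ∑ ε ∈ Γ, (if p ε = δ.target then (1 : ℤ) else 0) =
        (if a ∈ Γ then 1 else 0) + (if b ∈ Γ then 1 else 0) + (if c ∈ Γ then 1 else 0) := by
    intro p a b c hab hac hbc hp
    have : ∀ ε, (if p ε = δ.target then (1 : ℤ) else 0) =
        (if ε = a then 1 else 0) + (if ε = b then 1 else 0) + (if ε = c then 1 else 0) := by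
      intro ε
      simp only [hp]
      by_cases ha : ε = a
      · subst ha; simp [hab, hac]
      · by_cases hb : ε = b
        · subst hb; simp [ha, hbc]
        · simp [ha, hb]
    simp only [this, Finset.sum_add_distrib, Finset.sum_ite_eq']
  have ht := hsplit DirectedEdge.target δ δ₁ δ₂ hd.1 hd.2.1 hd.2.2 (fun ε => by
    rw [h₁, h₂]; exact DirectedEdge.target_eq_iff)
  have hinj := (Function.LeftInverse.injective DirectedEdge.rev_rev)
  have hs := hsplit DirectedEdge.source (DirectedEdge.rev δ) (DirectedEdge.rev δ₁)
    (DirectedEdge.rev δ₂) (hinj.ne hd.1) (hinj.ne hd.2.1) (hinj.ne hd.2.2) (fun ε => by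
    rw [h₁, h₂]; exact DirectedEdge.source_eq_target_iff)
  have hts : ∑ ε ∈ Γ, (if ε.target = δ.target then (1 : ℤ) else 0) =
      ∑ ε ∈ Γ, (if ε.source = δ.target then (1 : ℤ) else 0) := by
    rw [hΓ, List.sum_toFinset _ hn, List.sum_toFinset _ hn]
    have := congrArg (fun L => (L.map fun v => if v = δ.target then (1 : ℤ) else 0).sum) hγ
    simp only [List.map_rotate, List.map_map] at this
    rw [(List.rotate_perm _ 1).sum_eq] at this
    exact this
  rw [ht, hs] at hts
  rw [← h₁, ← h₂]
  simp only [edgeFlow]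
  linarith

/-- The winding numbers of a closed path around the cells. -/
theorem exists_cell_winding {γ : List DirectedEdge} (hn : γ.Nodup)
    (hγ : γ.map DirectedEdge.target = (γ.map DirectedEdge.source).rotate 1) :
    ∃ w : Cell → ℤ, ∀ δ : DirectedEdge, w δ.1 - w (δ.1 + dir δ.2) = edgeFlow γ.toFinset δ := by
  obtain ⟨f, hf⟩ : ∃ f, f = edgeFlow γ.toFinset := ⟨_, rfl⟩
  have hrev : ∀ δ, f (DirectedEdge.rev δ) = -f δ := by rw [hf]; exact edgeFlow_rev _
  have hc := edgeFlow_corner hn hγ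
  rw [← hf] at hc ⊢
  have hα : ∀ x y, f ((x, y), 0) + f ((x + 1, y), 2) - f ((x, y), 1) = 0 := by
    intro x y
    have h1 := hc ((x, y), 0)
    have h2 := hrev ((x, y), 1)
    simp [DirectedEdge.rev, dir] at h1 h2
    rw [h2] at h1
    linarith
  have hβ : ∀ x y, f ((x + 1, y), 1) - f ((x, y + 1), 0) - f ((x + 1, y), 2) = 0 := by
    intro x y
    have h1 := hc ((x + 1, y + 1), 3)
    have h2 := hrev ((x, y + 1), 0)
    have h3 := hrev ((x + 1, y), 2)
    simp [DirectedEdge.rev, dir] at h1 h2 h3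
    rw [h2, h3] at h1
    linarith
  -- Conservation at the corners says that the flow, read as a jump between neighbouring cells, is a
  -- closed form on the lattice of cells. Adding the relations at two adjacent corners removes the
  -- direction `2` and leaves the square condition.
  obtain ⟨g, hg⟩ := exists_potential (Q := Multiplicative ℤ)
    (fun x y => Multiplicative.ofAdd (-f ((x, y), 0)))
    (fun x y => Multiplicative.ofAdd (-f ((x, y), 1))) (by
      intro x y
      rw [← ofAdd_add, ← ofAdd_add]
      congr 1
      linarith [hα x y, hβ x y])
  obtain ⟨w, hw⟩ : ∃ w : Cell → ℤ, ∀ c, w c = (g c.1 c.2).toAdd := ⟨_, fun _ => rfl⟩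
  have h0 : ∀ x y, w (x + 1, y) = -f ((x, y), 0) + w (x, y) := by
    intro x y
    simp only [hw, (hg x y).1, toAdd_mul, toAdd_ofAdd]
  have h1 : ∀ x y, w (x, y + 1) = -f ((x, y), 1) + w (x, y) := by
    intro x y
    simp only [hw, (hg x y).2, toAdd_mul, toAdd_ofAdd]
  have h012 : ∀ c : Cell, ∀ d : Fin 6, d = 0 ∨ d = 1 ∨ d = 2 →
      w c - w (c + dir d) = f (c, d) := by
    rintro ⟨x, y⟩ d (rfl | rfl | rfl)
    · simp [dir, h0]
    · simp [dir, h1]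
    · have a1 := h0 (x - 1) (y + 1)
      have a2 := hα (x - 1) y
      have a3 := hβ (x - 1) y
      have a4 := h1 x y
      simp only [sub_add_cancel] at a1 a2 a3
      rw [show ((x, y) : Cell) + dir 2 = (x - 1, y + 1) by simp [dir]; rfl]
      linarith
  refine ⟨w, fun δ => ?_⟩
  by_cases hd : δ.2 = 0 ∨ δ.2 = 1 ∨ δ.2 = 2
  · exact h012 δ.1 δ.2 hd
  · have hd' : (DirectedEdge.rev δ).2 = 0 ∨ (DirectedEdge.rev δ).2 = 1 ∨
        (DirectedEdge.rev δ).2 = 2 := by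
      obtain ⟨c, d⟩ := δ
      simp only [DirectedEdge.rev] at hd ⊢
      revert d; decide
    have := h012 (DirectedEdge.rev δ).1 (DirectedEdge.rev δ).2 hd'
    rw [Prod.mk.eta, hrev] at this
    simp only [DirectedEdge.rev, dir_add_three, add_neg_cancel_right] at this
    linarith

/-- The side of the boundary of `C` that follows the side `δ`. -/
def nextEdge (C : Finset Cell) (δ : DirectedEdge) : DirectedEdge :=
  if δ.1 + dir (δ.2 + 1) ∈ C then (δ.1 + dir (δ.2 + 1), δ.2 + 5) else (δ.1, δ.2 + 1)

theorem nextEdge_mem {C : Finset Cell} {δ : DirectedEdge} (h : δ ∈ boundaryEdges C) :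
    nextEdge C δ ∈ boundaryEdges C := by
  rw [mem_boundaryEdges] at h
  unfold nextEdge
  split_ifs with h1
  · refine mem_boundaryEdges.2 ⟨h1, ?_⟩
    have : δ.1 + dir (δ.2 + 1) + dir (δ.2 + 5) = δ.1 + dir δ.2 := by
      rw [add_assoc]
      congr 1
      generalize δ.2 = d
      revert d; decide
    rw [this]
    exact h.2
  · exact mem_boundaryEdges.2 ⟨h.1, h1⟩

theorem source_nextEdge (C : Finset Cell) (δ : DirectedEdge) :
    (nextEdge C δ).source = δ.target := by
  unfold nextEdge
  obtain ⟨⟨x, y⟩, d⟩ := δ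
  split_ifs <;> fin_cases d <;> simp [DirectedEdge.target, DirectedEdge.source, dir] <;> omega

/-- Of the three sides that end at a given corner with their cells on the left, two boundary sides
would require one of the three cells to be both inside and outside `C`. -/
theorem nextEdge_injOn {C : Finset Cell} {δ ε : DirectedEdge} (hδ : δ ∈ boundaryEdges C)
    (hε : ε ∈ boundaryEdges C) (h : nextEdge C δ = nextEdge C ε) : δ = ε := by
  have h1 : ε.target = δ.target := by
    rw [← source_nextEdge C ε, ← h, source_nextEdge]
  rw [mem_boundaryEdges] at hδ hε
  rcases DirectedEdge.target_eq_iff.1 h1 with rfl | rfl | rfl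
  · rfl
  · exact absurd hε.1 hδ.2
  · refine absurd hδ.1 ?_
    have : δ.1 + dir (δ.2 + 1) + dir (δ.2 + 4) = δ.1 := by
      rw [add_assoc, add_eq_left]
      generalize δ.2 = d
      revert d; decide
    rw [← this]
    exact hε.2

/-- Every boundary side lies on a closed path of boundary sides. -/
theorem exists_boundary_cycle (C : Finset Cell) {δ : DirectedEdge} (hδ : δ ∈ boundaryEdges C) :
    ∃ γ : List DirectedEdge, δ ∈ γ ∧ γ.Nodup ∧ (∀ ε ∈ γ, ε ∈ boundaryEdges C) ∧
      γ.map DirectedEdge.target = (γ.map DirectedEdge.source).rotate 1 := by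
  -- The successor map is injective on a finite set, so the orbit of `δ` returns to `δ`; one minimal
  -- period visits no side twice.
  let f : boundaryEdges C → boundaryEdges C := fun ε => ⟨nextEdge C ε, nextEdge_mem ε.2⟩
  have hf : Function.Injective f := fun a b h =>
    Subtype.ext (nextEdge_injOn a.2 b.2 (congrArg Subtype.val h))
  obtain ⟨x, hx⟩ : ∃ x : boundaryEdges C, x = ⟨δ, hδ⟩ := ⟨_, rfl⟩
  have hp : x ∈ Function.periodicPts f := hf.mem_periodicPts x
  obtain ⟨k, hk⟩ : ∃ k, k = Function.minimalPeriod f x := ⟨_, rfl⟩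
  have hk0 : 0 < k := hk ▸ Function.minimalPeriod_pos_of_mem_periodicPts hp
  have hkx : f^[k] x = x := hk ▸ Function.isPeriodicPt_minimalPeriod f x
  refine ⟨(List.range k).map fun i => (f^[i] x).1, ?_, ?_, ?_, ?_⟩
  · exact List.mem_map.2 ⟨0, List.mem_range.2 hk0, by rw [hx]; rfl⟩
  · refine List.Nodup.map_on (fun i hi j hj h => ?_) List.nodup_range
    rw [List.mem_range] at hi hj
    exact Function.iterate_injOn_Iio_minimalPeriod (f := f) (x := x)
      (Set.mem_Iio.2 (hk ▸ hi)) (Set.mem_Iio.2 (hk ▸ hj)) (Subtype.ext h)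
  · intro ε hε
    obtain ⟨i, -, rfl⟩ := List.mem_map.1 hε
    exact (f^[i] x).2
  · refine List.ext_getElem (by simp) fun i h1 h2 => ?_
    simp only [List.length_map, List.length_range] at h1
    have hs : ∀ i, (f^[i] x).1.target = (f^[i + 1] x).1.source := by
      intro i
      rw [Function.iterate_succ_apply']
      exact (source_nextEdge C _).symm
    simp only [List.getElem_rotate, List.getElem_map, List.getElem_range, List.length_map,
      List.length_range, hs]
    rcases Nat.lt_or_ge (i + 1) k with h | h
    · rw [Nat.mod_eq_of_lt h]
    · obtain rfl : k = i + 1 := by omega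
      rw [Nat.mod_self, hkx]; rfl

theorem cellGraph_adj {c c' : Cell} (h : cellGraph.Adj c c') : ∃ d : Fin 6, c' = c + dir d := by
  rw [cellGraph, SimpleGraph.fromRel_adj] at h
  rcases h.2 with h | ⟨d, rfl⟩
  · exact h
  · exact ⟨d + 3, by rw [dir_add_three, add_neg_cancel_right]⟩

theorem eq_of_induce_connected {V α : Type*} {G : SimpleGraph V} {s : Set V} (w : V → α)
    (hs : (G.induce s).Connected) (hw : ∀ u ∈ s, ∀ v ∈ s, G.Adj u v → w u = w v) :
    ∀ u ∈ s, ∀ v ∈ s, w u = w v := by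
  intro u hu v hv
  obtain ⟨p⟩ := hs.preconnected ⟨u, hu⟩ ⟨v, hv⟩
  have : ∀ (a b : s), (G.induce s).Walk a b → w a = w b := by
    intro a b p
    induction p with
    | nil => rfl
    | cons h _ ih => exact (hw _ (Subtype.coe_prop _) _ (Subtype.coe_prop _) h).trans ih
  exact this _ _ p

theorem boundaryEdges_nonempty {C : Finset Cell} (hC : C.Nonempty) :
    (boundaryEdges C).Nonempty := by
  obtain ⟨c, hc, hmax⟩ := C.exists_max_image Prod.fst hC
  refine ⟨(c, 0), mem_boundaryEdges.2 ⟨hc, fun h => ?_⟩⟩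
  have := hmax _ h
  simp [dir] at this

/-- A simply connected region has an oriented boundary. -/
theorem IsSimplyConnectedRegion.exists_isOrientedBoundary {C : Finset Cell}
    (hC : IsSimplyConnectedRegion C) : ∃ γ, IsOrientedBoundary γ C := by
  have hne : C.Nonempty := by
    obtain ⟨⟨c, hc⟩⟩ := hC.1.nonempty
    exact ⟨c, hc⟩
  obtain ⟨δ₀, h₀⟩ := boundaryEdges_nonempty hne
  obtain ⟨γ, hmem, hnd, hB, hcl⟩ := exists_boundary_cycle C h₀
  obtain ⟨w, hw⟩ := exists_cell_winding hnd hcl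
  have hBi : ∀ ε ∈ boundaryEdges C, DirectedEdge.rev ε ∉ γ := by
    intro ε hε h
    exact (mem_boundaryEdges.1 hε).2 (mem_boundaryEdges.1 (hB _ h)).1
  -- The winding function `w` jumps only across sides of the path, and those separate `C` from its
  -- complement.
  have hconst : ∀ s : Set Cell, (∀ u ∈ s, ∀ v ∈ s, u ∈ C ↔ v ∈ C) →
      ∀ u ∈ s, ∀ v ∈ s, cellGraph.Adj u v → w u = w v := by
    intro s hs u hu v hv huv
    obtain ⟨d, rfl⟩ := cellGraph_adj huv
    have h := hw (u, d)
    have h1 : (u, d) ∉ γ := fun h => by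
      have := mem_boundaryEdges.1 (hB _ h)
      exact this.2 ((hs _ hu _ hv).1 this.1)
    have h2 : DirectedEdge.rev (u, d) ∉ γ := fun h => by
      have := mem_boundaryEdges.1 (hB _ h)
      simp only [DirectedEdge.rev, dir_add_three, add_neg_cancel_right] at this
      exact this.2 ((hs _ hv _ hu).1 this.1)
    simp only [edgeFlow, List.mem_toFinset, h1, h2, if_false, sub_zero] at h
    exact sub_eq_zero.1 h
  have hin := eq_of_induce_connected w hC.1
    (hconst _ fun u hu v hv => ⟨fun _ => hv, fun _ => hu⟩)
  have hout := eq_of_induce_connected w hC.2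
    (hconst _ fun u hu v hv => ⟨fun h => absurd h hu, fun h => absurd h hv⟩)
  refine ⟨γ, List.ne_nil_of_mem hmem, hnd, fun δ => ⟨fun h => mem_boundaryEdges.1 (hB _ h),
    fun h => ?_⟩, hcl⟩
  have hδ := mem_boundaryEdges.2 h
  have h1 := hw δ
  have h2 := hw δ₀
  rw [mem_boundaryEdges] at h₀
  -- As `w` is constant on `C` and constant off `C`, its jump across any boundary side equals the
  -- jump `1` across `δ₀`. A boundary side missing from the path would have jump `0`.
  rw [hin _ h.1 _ h₀.1, hout _ h.2 _ h₀.2, h2] at h1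
  have h3 := hBi _ (mem_boundaryEdges.2 h₀)
  have h4 := hBi _ hδ
  simp only [edgeFlow, List.mem_toFinset, hmem, h3, h4, if_true, if_false, sub_zero] at h1
  by_contra hcon
  simp [hcon] at h1

/-! ## Geometry of the plaquettes and of the tiles of their sites -/

theorem mem_translateCells {a c : Cell} {T : Finset Cell} :
    c ∈ translateCells a T ↔ c - a ∈ T := by
  simp only [translateCells, Finset.mem_image]
  constructor
  · rintro ⟨x, hx, rfl⟩; simpa using hx
  · intro h; exact ⟨_, h, by simp⟩

/-- The 19 cells of a plaquette with centre `0`. -/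
def hexagonCells : Finset Cell :=
  insert (0, 0) (Finset.univ.biUnion fun d : Fin 6 =>
    {dir d, dir d + dir d, dir d + dir (d + 1)})

theorem mem_plaquetteCells {p : Plaquette} {c : Cell} :
    c ∈ plaquetteCells p ↔ c - plaquetteCentre p ∈ hexagonCells := mem_translateCells

/-- The sites of a plaquette, counterclockwise. -/
def cornerSite (p : Plaquette) : Fin 6 → Site :=
  ![(Sublat.B, p + (1, 0)), (Sublat.A, p), (Sublat.B, p + (0, 1)),
    (Sublat.A, p - (1, 0)), (Sublat.B, p), (Sublat.A, p - (0, 1))]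

/-- The particle tile of a corner of the plaquette with centre `0`. -/
def cornerParticle (k : Fin 6) : Finset Cell :=
  {dir k + dir k, dir k + dir k + dir k, dir k + dir k + dir (k - 1)}

/-- The hole tile of a corner of the plaquette with centre `0`. -/
def cornerHole (k : Fin 6) : Finset Cell :=
  cornerParticle k ∪ {dir k + dir (k - 1), dir k + dir k + dir k + dir (k - 1),
    dir k + dir k + dir (k + 1)}

/-- The tile of a corner of the plaquette with centre `0`. -/
def cornerTile (b : Bool) (k : Fin 6) : Finset Cell :=
  if b = true then cornerParticle k else cornerHole k

/-- The middle region of a plaquette with centre `0`. -/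
def midCells (b : Fin 6 → Bool) : Finset Cell :=
  hexagonCells \ Finset.univ.biUnion fun k => cornerTile (b k) k

theorem plaquetteSites_eq (p : Plaquette) :
    plaquetteSites p = Finset.univ.image (cornerSite p) := by
  ext s
  simp [plaquetteSites, cornerSite, Fin.exists_fin_succ, eq_comm]
  tauto

theorem mem_plaquetteSites {p : Plaquette} {s : Site} :
    s ∈ plaquetteSites p ↔ ∃ k, cornerSite p k = s := by
  simp [plaquetteSites_eq]

theorem cornerSite_injective (p : Plaquette) : Function.Injective (cornerSite p) := by
  obtain ⟨i, j⟩ := p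
  intro a b
  fin_cases a <;> fin_cases b <;> simp [cornerSite] <;> omega

theorem exists_eq_cornerSite (s : Site) : ∃ k, (k = 1 ∨ k = 4) ∧ s = cornerSite s.2 k := by
  obtain ⟨S, p⟩ := s
  cases S
  · exact ⟨1, Or.inl rfl, rfl⟩
  · exact ⟨4, Or.inr rfl, rfl⟩

theorem particleTile_cornerSite (p : Plaquette) (k : Fin 6) :
    particleTile (cornerSite p k) = translateCells (plaquetteCentre p) (cornerParticle k) := by
  obtain ⟨i, j⟩ := p
  ext ⟨x, y⟩
  rw [mem_translateCells]
  fin_cases k <;>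
    simp [particleTile, cornerParticle, cornerSite, mem_translateCells, plaquetteCentre,
      sublatticeSign, dir, Prod.ext_iff] <;> omega

theorem holeTile_cornerSite (p : Plaquette) (k : Fin 6) :
    holeTile (cornerSite p k) = translateCells (plaquetteCentre p) (cornerHole k) := by
  ext c
  rw [holeTile, cornerHole, Finset.mem_union, particleTile_cornerSite, mem_translateCells,
    mem_translateCells, mem_translateCells, Finset.mem_union]
  refine or_congr Iff.rfl ?_
  obtain ⟨i, j⟩ := p
  obtain ⟨x, y⟩ := c
  fin_cases k <;>
    simp [cornerSite, plaquetteCentre,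
      sublatticeSign, dir, Prod.ext_iff] <;> omega

theorem siteTile_cornerSite (n : Config) (p : Plaquette) (k : Fin 6) :
    siteTile n (cornerSite p k) =
      translateCells (plaquetteCentre p) (cornerTile (n (cornerSite p k)) k) := by
  unfold siteTile cornerTile
  rw [particleTile_cornerSite, holeTile_cornerSite]
  split_ifs <;> rfl

theorem middleRegion_eq (n : Config) (p : Plaquette) :
    middleRegion n p =
      translateCells (plaquetteCentre p) (midCells fun k => n (cornerSite p k)) := by
  ext c
  simp only [middleRegion, midCells, mem_translateCells, Finset.mem_sdiff, mem_plaquetteCells,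
    Finset.mem_biUnion, plaquetteSites_eq, Finset.mem_image, Finset.mem_univ, true_and,
    exists_exists_eq_and, siteTile_cornerSite]

theorem cornerParticle_subset_cornerTile (b : Bool) (k : Fin 6) :
    cornerParticle k ⊆ cornerTile b k := by
  revert b k; decide

theorem particleTile_subset_siteTile (n : Config) (s : Site) : particleTile s ⊆ siteTile n s := by
  unfold siteTile holeTile
  split_ifs
  · exact subset_rfl
  · exact Finset.subset_union_left

theorem siteTile_subset_holeTile (n : Config) (s : Site) : siteTile n s ⊆ holeTile s := by
  unfold siteTile
  split_ifs
  · exact Finset.subset_union_left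
  · exact subset_rfl

/-- The plaquette centres form a lattice of index 19, the kernel of `x + 8y` modulo 19, and the 19
cells of a hexagon represent every residue once. -/
theorem exists_mem_plaquetteCells (c : Cell) : ∃ p, c ∈ plaquetteCells p := by
  have h : ∀ r : Fin 19, ∃ o ∈ hexagonCells, (o.1 + 8 * o.2) % 19 = (r.val : ℤ) := by decide
  obtain ⟨x, y⟩ := c
  obtain ⟨o, ho, hr⟩ := h ⟨((x + 8 * y) % 19).toNat, by omega⟩
  simp only at hr
  obtain ⟨k, hk⟩ : ∃ k, k = ((x - o.1) + 8 * (y - o.2)) / 19 := ⟨_, rfl⟩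
  -- This solves `3i - 2j = x - o.1`, `2i + 5j = y - o.2` by Cramer's rule with determinant 19.
  refine ⟨(5 * k - 2 * (y - o.2), (y - o.2) - 2 * k), ?_⟩
  rw [mem_plaquetteCells]
  convert ho using 1
  rw [Prod.ext_iff]
  simp only [plaquetteCentre, Prod.fst_sub, Prod.snd_sub]
  omega

theorem eq_of_sub_plaquetteCentre {T : Finset Cell}
    (hT : ∀ o ∈ T, ∀ o' ∈ T, (o.1 + 8 * o.2) % 19 = (o'.1 + 8 * o'.2) % 19 → o = o')
    {c : Cell} {p q : Plaquette} (hp : c - plaquetteCentre p ∈ T)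
    (hq : c - plaquetteCentre q ∈ T) : p = q := by
  obtain ⟨i, j⟩ := p
  obtain ⟨i', j'⟩ := q
  have := hT _ hp _ hq (by simp only [plaquetteCentre, Prod.fst_sub, Prod.snd_sub]; omega)
  simp only [plaquetteCentre, sub_right_inj, Prod.mk.injEq] at this ⊢
  omega

theorem plaquette_eq_of_mem {c : Cell} {p q : Plaquette} (hp : c ∈ plaquetteCells p)
    (hq : c ∈ plaquetteCells q) : p = q :=
  eq_of_sub_plaquetteCentre (T := hexagonCells) (by decide) (mem_plaquetteCells.1 hp)
    (mem_plaquetteCells.1 hq)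

/-- Every site is corner `1` or `4` of the plaquette with its own index. The twelve cells of these
two hole tiles have distinct residues under `x + 8y` modulo 19, so their lattice translates are
disjoint. -/
theorem site_eq_of_mem_holeTile {c : Cell} {s t : Site} (hs : c ∈ holeTile s)
    (ht : c ∈ holeTile t) : s = t := by
  obtain ⟨k, hk, hsk⟩ := exists_eq_cornerSite s
  obtain ⟨l, hl, htl⟩ := exists_eq_cornerSite t
  rw [hsk, holeTile_cornerSite, mem_translateCells] at hs
  rw [htl, holeTile_cornerSite, mem_translateCells] at ht
  have hsub : ∀ k : Fin 6, k = 1 ∨ k = 4 → cornerHole k ⊆ cornerHole 1 ∪ cornerHole 4 := by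
    rintro k (rfl | rfl)
    · exact Finset.subset_union_left
    · exact Finset.subset_union_right
  have e : s.2 = t.2 := eq_of_sub_plaquetteCentre (T := cornerHole 1 ∪ cornerHole 4) (by decide)
    (hsub k hk hs) (hsub l hl ht)
  rw [e] at hs
  have hkl : k = l := by
    have : Disjoint (cornerHole 1) (cornerHole 4) := by decide
    rw [Finset.disjoint_left] at this
    rcases hk with rfl | rfl <;> rcases hl with rfl | rfl
    · rfl
    · exact absurd ht (this hs)
    · exact absurd hs (this ht)
    · rfl
  rw [hsk, htl, hkl, e]

theorem mem_plaquetteSites_of_mem_holeTile {c : Cell} {s : Site} {p : Plaquette}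
    (hs : c ∈ holeTile s) (hp : c ∈ plaquetteCells p) : s ∈ plaquetteSites p := by
  obtain ⟨S, i, j⟩ := s
  have key : ∀ q : Plaquette, (c - plaquetteCentre q) ∈ hexagonCells → p = q := fun q hq =>
    plaquette_eq_of_mem hp (mem_plaquetteCells.2 hq)
  cases S
  · have h := holeTile_cornerSite (i, j) 1
    rw [show cornerSite (i, j) 1 = (Sublat.A, (i, j)) from rfl] at h
    rw [h, mem_translateCells] at hs
    -- The vectors `(3, 2)` and `(-2, 5)` lead from the centre of a plaquette to those of its
    -- neighbours in the two coordinate directions; a hole tile lies in the three plaquettes of its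
    -- site.
    have hd : ∀ o ∈ cornerHole 1, o ∈ hexagonCells ∨ o - (3, 2) ∈ hexagonCells ∨
        o - (-2, 5) ∈ hexagonCells := by decide
    rcases hd _ hs with h | h | h
    · rw [key _ h]; simp [plaquetteSites]
    · rw [key (i + 1, j) (by
        convert h using 1; ext <;> simp [plaquetteCentre] <;> ring)]
      simp [plaquetteSites]
    · rw [key (i, j + 1) (by
        convert h using 1; ext <;> simp [plaquetteCentre] <;> ring)]
      simp [plaquetteSites]
  · have h := holeTile_cornerSite (i, j) 4
    rw [show cornerSite (i, j) 4 = (Sublat.B, (i, j)) from rfl] at h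
    rw [h, mem_translateCells] at hs
    have hd : ∀ o ∈ cornerHole 4, o ∈ hexagonCells ∨ o + (3, 2) ∈ hexagonCells ∨
        o + (-2, 5) ∈ hexagonCells := by decide
    rcases hd _ hs with h | h | h
    · rw [key _ h]; simp [plaquetteSites]
    · rw [key (i - 1, j) (by
        convert h using 1; ext <;> simp [plaquetteCentre] <;> ring)]
      simp [plaquetteSites]
    · rw [key (i, j - 1) (by
        convert h using 1; ext <;> simp [plaquetteCentre] <;> ring)]
      simp [plaquetteSites]

/-- The tiles of the sites and the middle regions of the plaquettes. -/
def pieceCells (n : Config) : Site ⊕ Plaquette → Finset Cell :=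
  Sum.elim (siteTile n) (middleRegion n)

theorem mem_piece_of_mem_plaquetteCells (n : Config) {p : Plaquette} {c : Cell}
    (h : c ∈ plaquetteCells p) :
    c ∈ middleRegion n p ∨ ∃ s ∈ plaquetteSites p, c ∈ siteTile n s := by
  by_cases hc : ∃ s ∈ plaquetteSites p, c ∈ siteTile n s
  · exact Or.inr hc
  · left
    simpa only [middleRegion, Finset.mem_sdiff, Finset.mem_biUnion, h, true_and] using hc

theorem exists_mem_pieceCells (n : Config) (c : Cell) : ∃ r, c ∈ pieceCells n r := by
  obtain ⟨p, hp⟩ := exists_mem_plaquetteCells c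
  rcases mem_piece_of_mem_plaquetteCells n hp with h | ⟨s, -, h⟩
  · exact ⟨Sum.inr p, h⟩
  · exact ⟨Sum.inl s, h⟩

theorem middleRegion_subset (n : Config) (p : Plaquette) :
    middleRegion n p ⊆ plaquetteCells p := Finset.sdiff_subset

theorem not_mem_siteTile_of_mem_middleRegion {n : Config} {p : Plaquette} {s : Site} {c : Cell}
    (hp : c ∈ middleRegion n p) : c ∉ siteTile n s := by
  intro hs
  have h := mem_plaquetteSites_of_mem_holeTile (siteTile_subset_holeTile n s hs)
    (middleRegion_subset n p hp)
  exact (Finset.mem_sdiff.1 hp).2 (Finset.mem_biUnion.2 ⟨s, h, hs⟩)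

/-- Together with `exists_mem_pieceCells` this makes the pieces a partition of the plane, for any
configuration. -/
theorem piece_eq_of_mem {n : Config} {c : Cell} {r r' : Site ⊕ Plaquette}
    (h : c ∈ pieceCells n r) (h' : c ∈ pieceCells n r') : r = r' := by
  rcases r with s | p <;> rcases r' with s' | p'
  · rw [site_eq_of_mem_holeTile (siteTile_subset_holeTile n s h)
      (siteTile_subset_holeTile n s' h')]
  · exact absurd h (not_mem_siteTile_of_mem_middleRegion h')
  · exact absurd h' (not_mem_siteTile_of_mem_middleRegion h)
  · rw [plaquette_eq_of_mem (middleRegion_subset n p h) (middleRegion_subset n p' h')]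

/-- The pieces that make up the tiled region of `R`. -/
def regionPieces (R : Finset Plaquette) : Finset (Site ⊕ Plaquette) :=
  (regionSites R).disjSum R

theorem tiledRegion_eq_biUnion (n : Config) (R : Finset Plaquette) :
    tiledRegion n R = (regionPieces R).biUnion (pieceCells n) := by
  ext c
  simp [tiledRegion, regionPieces, pieceCells, or_comm]

theorem mem_tiledRegion_iff {n : Config} {R : Finset Plaquette} {c : Cell} {r : Site ⊕ Plaquette}
    (hr : c ∈ pieceCells n r) : c ∈ tiledRegion n R ↔ r ∈ regionPieces R := by
  rw [tiledRegion_eq_biUnion, Finset.mem_biUnion]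
  constructor
  · rintro ⟨r', h, h'⟩
    rwa [piece_eq_of_mem hr h']
  · intro h; exact ⟨r, h, hr⟩

theorem plaquetteCells_subset_tiledRegion (n : Config) {R : Finset Plaquette} {p : Plaquette}
    (hp : p ∈ R) : plaquetteCells p ⊆ tiledRegion n R := by
  intro c hc
  rcases mem_piece_of_mem_plaquetteCells n hc with h | ⟨s, hs, h⟩
  · exact (mem_tiledRegion_iff (r := Sum.inr p) h).2 (by simpa [regionPieces])
  · exact (mem_tiledRegion_iff (r := Sum.inl s) h).2
      (Finset.inl_mem_disjSum.2 (Finset.mem_biUnion.2 ⟨p, hp, hs⟩))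

/-! ## Connectedness -/

/-- Two vertices are joined by a path in `s`. -/
def JoinedWithin {V : Type*} (G : SimpleGraph V) (s : Set V) (u v : V) : Prop :=
  ∃ (hu : u ∈ s) (hv : v ∈ s), (G.induce s).Reachable ⟨u, hu⟩ ⟨v, hv⟩

namespace JoinedWithin

variable {V : Type*} {G : SimpleGraph V} {s t : Set V} {u v w : V}

theorem refl (hu : u ∈ s) : JoinedWithin G s u u := ⟨hu, hu, SimpleGraph.Reachable.refl _⟩

theorem symm (h : JoinedWithin G s u v) : JoinedWithin G s v u :=
  let ⟨hu, hv, h⟩ := h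
  ⟨hv, hu, h.symm⟩

theorem trans (h : JoinedWithin G s u v) (h' : JoinedWithin G s v w) : JoinedWithin G s u w :=
  let ⟨hu, _, h⟩ := h
  let ⟨_, hw, h'⟩ := h'
  ⟨hu, hw, h.trans h'⟩

theorem of_adj (hu : u ∈ s) (hv : v ∈ s) (h : G.Adj u v) : JoinedWithin G s u v :=
  ⟨hu, hv, SimpleGraph.Adj.reachable (G := G.induce s) (u := ⟨u, hu⟩) (v := ⟨v, hv⟩) h⟩

theorem connected (hne : s.Nonempty) (h : ∀ u ∈ s, ∀ v ∈ s, JoinedWithin G s u v) :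
    (G.induce s).Connected := by
  have : Nonempty s := hne.to_subtype
  refine ⟨fun u v => ?_⟩
  obtain ⟨_, _, h⟩ := h _ u.2 _ v.2
  exact h

end JoinedWithin

theorem rel_of_induce_connected {V : Type*} {G : SimpleGraph V} {s : Set V} (r : V → V → Prop)
    (hs : (G.induce s).Connected) (hrefl : ∀ u ∈ s, r u u)
    (htrans : ∀ u v w, r u v → r v w → r u w)
    (hadj : ∀ u ∈ s, ∀ v ∈ s, G.Adj u v → r u v) : ∀ u ∈ s, ∀ v ∈ s, r u v := by
  intro u hu v hv
  obtain ⟨p⟩ := hs.preconnected ⟨u, hu⟩ ⟨v, hv⟩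
  have : ∀ (a b : s), (G.induce s).Walk a b → r a b := by
    intro a b p
    induction p with
    | nil => exact hrefl _ (Subtype.coe_prop _)
    | cons h _ ih =>
      exact htrans _ _ _ (hadj _ (Subtype.coe_prop _) _ (Subtype.coe_prop _) h) ih
  exact this _ _ p

theorem dir_ne_zero (d : Fin 6) : dir d ≠ 0 := by revert d; decide

theorem cellGraph_adj_add_dir (c : Cell) (d : Fin 6) : cellGraph.Adj c (c + dir d) := by
  rw [cellGraph, SimpleGraph.fromRel_adj]
  exact ⟨fun h => dir_ne_zero d (left_eq_add.1 h), Or.inl ⟨d, rfl⟩⟩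

/-- The centre of a plaquette and its six neighbours lie in `s`. -/
def CoreSubset (p : Plaquette) (s : Set Cell) : Prop :=
  plaquetteCentre p ∈ s ∧ ∀ d, plaquetteCentre p + dir d ∈ s

theorem CoreSubset.joined_centre {p : Plaquette} {s : Set Cell} (h : CoreSubset p s) {c : Cell}
    (hc : c ∈ plaquetteCells p) (hs : c ∈ s) :
    JoinedWithin cellGraph s (plaquetteCentre p) c := by
  have hd : ∀ o ∈ hexagonCells, o = 0 ∨ ∃ d, o = dir d ∨ ∃ d', o = dir d + dir d' := by decide
  have hcore : ∀ d, JoinedWithin cellGraph s (plaquetteCentre p) (plaquetteCentre p + dir d) :=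
    fun d => .of_adj h.1 (h.2 d) (cellGraph_adj_add_dir _ _)
  rcases hd _ (mem_plaquetteCells.1 hc) with h0 | ⟨d, h0 | ⟨d', h0⟩⟩
  · obtain rfl := sub_eq_zero.1 h0
    exact .refl hs
  · obtain rfl := eq_add_of_sub_eq' h0
    exact hcore d
  · obtain rfl := eq_add_of_sub_eq' h0
    refine (hcore d).trans (.of_adj (h.2 d) hs ?_)
    rw [← add_assoc]
    exact cellGraph_adj_add_dir _ _

theorem joined_cornerTile {s : Set Cell} (p : Plaquette) (b : Bool) (k : Fin 6)
    (h : ∀ o ∈ cornerTile b k, plaquetteCentre p + o ∈ s) :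
    ∀ o ∈ cornerTile b k, ∀ o' ∈ cornerTile b k,
      JoinedWithin cellGraph s (plaquetteCentre p + o) (plaquetteCentre p + o') := by
  have hd : ∀ b k, ∀ o ∈ cornerTile b k, o = dir k + dir k ∨ ∃ d, o = dir k + dir k + dir d ∨
      ∃ d', dir k + dir k + dir d ∈ cornerTile b k ∧ o = dir k + dir k + dir d + dir d' := by
    decide
  have hk : dir k + dir k ∈ cornerTile b k :=
    cornerParticle_subset_cornerTile b k (by simp [cornerParticle])
  have hj : ∀ o ∈ cornerTile b k, JoinedWithin cellGraph s (plaquetteCentre p + (dir k + dir k))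
      (plaquetteCentre p + o) := by
    intro o ho
    rcases hd b k o ho with rfl | ⟨d, rfl | ⟨d', h1, rfl⟩⟩
    · exact .refl (h _ ho)
    · refine .of_adj (h _ hk) (h _ ho) ?_
      rw [← add_assoc _ _ (dir d)]
      exact cellGraph_adj_add_dir _ _
    · refine (JoinedWithin.of_adj (h _ hk) (h _ h1) ?_).trans (.of_adj (h _ h1) (h _ ho) ?_)
      · rw [← add_assoc _ _ (dir d)]
        exact cellGraph_adj_add_dir _ _
      · rw [← add_assoc _ _ (dir d')]
        exact cellGraph_adj_add_dir _ _
  exact fun o ho o' ho' => (hj o ho).symm.trans (hj o' ho')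

theorem joined_siteTile {s : Set Cell} {n : Config} {σ : Site} (h : (siteTile n σ : Set Cell) ⊆ s)
    {c c' : Cell} (hc : c ∈ siteTile n σ) (hc' : c' ∈ siteTile n σ) :
    JoinedWithin cellGraph s c c' := by
  obtain ⟨k, -, hk⟩ := exists_eq_cornerSite σ
  rw [hk, siteTile_cornerSite] at hc hc' h
  rw [mem_translateCells] at hc hc'
  have := joined_cornerTile (s := s) σ.2 _ k (fun o ho => h (by
    rw [Finset.mem_coe, mem_translateCells]; simpa using ho)) _ hc _ hc'
  simpa using this

theorem exists_mem_particleTile_plaquetteCells {σ : Site} {p : Plaquette}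
    (h : σ ∈ plaquetteSites p) : ∃ c, c ∈ particleTile σ ∧ c ∈ plaquetteCells p := by
  obtain ⟨k, rfl⟩ := mem_plaquetteSites.1 h
  refine ⟨plaquetteCentre p + (dir k + dir k), ?_, ?_⟩
  · rw [particleTile_cornerSite, mem_translateCells, add_sub_cancel_left]
    simp [cornerParticle]
  · rw [mem_plaquetteCells, add_sub_cancel_left]
    clear h
    revert k; decide

/-- The tile of a common site is connected and meets both hexagons, so it is a bridge between the
two centres. This carries adjacency of plaquettes to connectedness of cells, inside the region and
outside it. -/
theorem CoreSubset.joined_of_site {p q : Plaquette} {s : Set Cell} (hp : CoreSubset p s)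
    (hq : CoreSubset q s) {n : Config} {σ : Site} (hσ : (siteTile n σ : Set Cell) ⊆ s)
    (hσp : σ ∈ plaquetteSites p) (hσq : σ ∈ plaquetteSites q) :
    JoinedWithin cellGraph s (plaquetteCentre p) (plaquetteCentre q) := by
  obtain ⟨c, h1, h2⟩ := exists_mem_particleTile_plaquetteCells hσp
  obtain ⟨c', h3, h4⟩ := exists_mem_particleTile_plaquetteCells hσq
  have h1' := particleTile_subset_siteTile n σ h1
  have h3' := particleTile_subset_siteTile n σ h3
  exact ((hp.joined_centre h2 (hσ h1')).trans (joined_siteTile hσ h1' h3')).trans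
    (hq.joined_centre h4 (hσ h3')).symm

theorem coreSubset_plaquetteCells (p : Plaquette) : CoreSubset p (plaquetteCells p) := by
  refine ⟨?_, fun d => ?_⟩
  · rw [Finset.mem_coe, mem_plaquetteCells, sub_self]; decide
  · rw [Finset.mem_coe, mem_plaquetteCells, add_sub_cancel_left]
    revert d; decide

/-- Even the hole tiles reach only the outer ring of the hexagon, so the centre and its neighbours
always belong to the middle region. -/
theorem coreSubset_middleRegion (n : Config) (p : Plaquette) :
    CoreSubset p (middleRegion n p) := by
  have h : ∀ c ∈ plaquetteCells p, (∀ k, c - plaquetteCentre p ∉ cornerHole k) →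
      c ∈ middleRegion n p := by
    intro c hc hk
    refine Finset.mem_sdiff.2 ⟨hc, fun hm => ?_⟩
    obtain ⟨σ, h1, h2⟩ := Finset.mem_biUnion.1 hm
    obtain ⟨k, rfl⟩ := mem_plaquetteSites.1 h1
    have := siteTile_subset_holeTile n _ h2
    rw [holeTile_cornerSite, mem_translateCells] at this
    exact hk k this
  have h0 := coreSubset_plaquetteCells p
  refine ⟨h _ h0.1 ?_, fun d => h _ (h0.2 d) ?_⟩
  · rw [sub_self]; decide
  · rw [add_sub_cancel_left]; revert d; decide

theorem plaquetteGraph_adj {X : Set Site} {p q : Plaquette} (h : (plaquetteGraph X).Adj p q) :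
    ∃ s ∈ X, s ∈ plaquetteSites p ∧ s ∈ plaquetteSites q := by
  rw [plaquetteGraph, SimpleGraph.fromRel_adj] at h
  rcases h.2 with h | ⟨s, h1, h2, h3⟩
  · exact h
  · exact ⟨s, h1, h3, h2⟩

theorem CoreSubset.mono {p : Plaquette} {s t : Set Cell} (h : CoreSubset p s) (hst : s ⊆ t) :
    CoreSubset p t := ⟨hst h.1, fun d => hst (h.2 d)⟩

theorem siteTile_subset_tiledRegion (n : Config) {R : Finset Plaquette} {σ : Site}
    (hσ : σ ∈ regionSites R) : siteTile n σ ⊆ tiledRegion n R := fun c hc =>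
  (mem_tiledRegion_iff (r := Sum.inl σ) hc).2 (by simpa [regionPieces])

/-- The tiled region of a simply connected set of plaquettes is simply connected. -/
theorem IsPlaquetteDisc.isSimplyConnectedRegion {R : Finset Plaquette} (hR : IsPlaquetteDisc R)
    (n : Config) : IsSimplyConnectedRegion (tiledRegion n R) := by
  constructor
  · have hcore : ∀ p ∈ R, CoreSubset p (tiledRegion n R : Set Cell) := fun p hp =>
      (coreSubset_plaquetteCells p).mono (plaquetteCells_subset_tiledRegion n hp)
    have hp := rel_of_induce_connected
      (fun p q => JoinedWithin cellGraph (tiledRegion n R : Set Cell) (plaquetteCentre p)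
        (plaquetteCentre q)) hR.1 (fun p hp => .refl (hcore p hp).1)
      (fun _ _ _ h h' => h.trans h') (fun p hp q hq hpq => by
        obtain ⟨σ, -, h1, h2⟩ := plaquetteGraph_adj hpq
        exact (hcore p hp).joined_of_site (hcore q hq)
          (siteTile_subset_tiledRegion n (Finset.mem_biUnion.2 ⟨p, hp, h1⟩)) h1 h2)
    have hc : ∀ c ∈ tiledRegion n R, ∃ p ∈ R,
        JoinedWithin cellGraph (tiledRegion n R : Set Cell) (plaquetteCentre p) c := by
      intro c hc
      have hc' := hc
      rw [tiledRegion, Finset.mem_union, Finset.mem_biUnion, Finset.mem_biUnion] at hc'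
      rcases hc' with ⟨p, hp, h⟩ | ⟨σ, hσ, h⟩
      · exact ⟨p, hp, (hcore p hp).joined_centre (middleRegion_subset n p h) hc⟩
      · obtain ⟨p, hp, hσp⟩ := Finset.mem_biUnion.1 hσ
        obtain ⟨c', h1, h2⟩ := exists_mem_particleTile_plaquetteCells hσp
        have h3 := particleTile_subset_siteTile n σ h1
        have h4 := siteTile_subset_tiledRegion n hσ
        exact ⟨p, hp, ((hcore p hp).joined_centre h2 (h4 h3)).trans (joined_siteTile h4 h3 h)⟩
    obtain ⟨⟨p₀, hp₀⟩⟩ := hR.1.nonempty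
    refine JoinedWithin.connected ⟨_, (hcore p₀ hp₀).1⟩ fun c h c' h' => ?_
    obtain ⟨p, h1, h2⟩ := hc c h
    obtain ⟨q, h3, h4⟩ := hc c' h'
    exact (h2.symm.trans (hp p h1 q h3)).trans h4
  · have hcore : ∀ p ∉ R, CoreSubset p (tiledRegion n R : Set Cell)ᶜ := fun p hp =>
      (coreSubset_middleRegion n p).mono fun c hc hc' =>
        hp (by simpa [regionPieces] using (mem_tiledRegion_iff (r := Sum.inr p) hc).1 hc')
    have hp := rel_of_induce_connected
      (fun p q => JoinedWithin cellGraph (tiledRegion n R : Set Cell)ᶜ (plaquetteCentre p)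
        (plaquetteCentre q)) hR.2 (fun p hp => .refl (hcore p hp).1)
      (fun _ _ _ h h' => h.trans h') (fun p hp q hq hpq => by
        obtain ⟨σ, h0, h1, h2⟩ := plaquetteGraph_adj hpq
        exact (hcore p hp).joined_of_site (hcore q hq) (n := n) (fun c hc hc' =>
          h0 (by simpa [regionPieces] using (mem_tiledRegion_iff (r := Sum.inl σ) hc).1 hc')) h1 h2)
    have hc : ∀ c ∉ tiledRegion n R, ∃ p ∉ R,
        JoinedWithin cellGraph (tiledRegion n R : Set Cell)ᶜ (plaquetteCentre p) c := by
      intro c hc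
      obtain ⟨p, h⟩ := exists_mem_plaquetteCells c
      -- A plaquette of `R` is contained in the tiled region with all its cells, so a cell outside
      -- the region lies in a plaquette outside `R`.
      have hpR : p ∉ R := fun hpR => hc (plaquetteCells_subset_tiledRegion n hpR h)
      exact ⟨p, hpR, (hcore p hpR).joined_centre h hc⟩
    obtain ⟨⟨p₀, hp₀⟩⟩ := hR.2.nonempty
    refine JoinedWithin.connected ⟨_, (hcore p₀ hp₀).1⟩ fun c h c' h' => ?_
    obtain ⟨p, h1, h2⟩ := hc c h
    obtain ⟨q, h3, h4⟩ := hc c' h'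
    exact (h2.symm.trans (hp p h1 q h3)).trans h4

/-! ## The winding invariant of a tiled region -/

/-- The five tiles. -/
def baseTile : Fin 5 → Finset Cell :=
  ![{(0, 0), (1, 0), (0, 1)}, {(0, 0), (-1, 0), (0, -1)}, {(0, 0), (1, 0), (2, 0)},
    {(0, 0), (0, 1), (0, 2)}, {(0, 0), (1, -1), (2, -2)}]

/-- The winding invariants of the five tiles. -/
def tileWeight : Fin 5 → ℤ := ![1, -1, 0, 0, 0]

/-- The cells of a translate of one of the five tiles. -/
def tileCells (t : Cell × Fin 5) : Finset Cell := translateCells t.1 (baseTile t.2)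

theorem isTile_tileCells (t : Cell × Fin 5) : IsTile (tileCells t) := by
  obtain ⟨c, k⟩ := t
  refine ⟨c, baseTile k, ?_, rfl⟩
  fin_cases k <;> simp [baseTile, tileSet₁, tileSet₂]

/-- Labels for the sides inside the tiles. -/
def innerLabel : Fin 5 → DirectedEdge → FreeGroup Gen
  | 0, δ =>
    if δ = ((0, 0), 0) then genA * genU * genA⁻¹
    else if δ = ((1, 0), 3) then (genA * genU * genA⁻¹)⁻¹
    else if δ = ((1, 0), 2) then genA * genU * genA⁻¹ * genA⁻¹ * genU⁻¹ * genA
    else if δ = ((0, 1), 5) then (genA * genU * genA⁻¹ * genA⁻¹ * genU⁻¹ * genA)⁻¹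
    else edgeLetter δ
  | 1, δ =>
    if δ = ((0, 0), 3) then genA⁻¹ * genU⁻¹ * genA
    else if δ = ((-1, 0), 0) then (genA⁻¹ * genU⁻¹ * genA)⁻¹
    else if δ = ((-1, 0), 5) then genA⁻¹ * genU⁻¹ * genA * genA * genU * genA⁻¹
    else if δ = ((0, -1), 2) then (genA⁻¹ * genU⁻¹ * genA * genA * genU * genA⁻¹)⁻¹
    else edgeLetter δ
  | 2, δ =>
    if δ = ((0, 0), 0) then genA * genU * genA⁻¹
    else if δ = ((1, 0), 3) then (genA * genU * genA⁻¹)⁻¹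
    else if δ = ((1, 0), 0) then genA * genA * genU * genA⁻¹ * genA⁻¹
    else if δ = ((2, 0), 3) then (genA * genA * genU * genA⁻¹ * genA⁻¹)⁻¹
    else edgeLetter δ
  | 3, δ =>
    if δ = ((0, 0), 1) then genU * genA⁻¹ * genU⁻¹
    else if δ = ((0, 1), 4) then (genU * genA⁻¹ * genU⁻¹)⁻¹
    else if δ = ((0, 1), 1) then genU * genU * genA⁻¹ * genU⁻¹ * genU⁻¹
    else if δ = ((0, 2), 4) then (genU * genU * genA⁻¹ * genU⁻¹ * genU⁻¹)⁻¹
    else edgeLetter δ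
  | 4, δ =>
    if δ = ((0, 0), 5) then genU⁻¹ * genA * genU * genA⁻¹
    else if δ = ((1, -1), 2) then (genU⁻¹ * genA * genU * genA⁻¹)⁻¹
    else if δ = ((1, -1), 5) then
      genU⁻¹ * genA * genU⁻¹ * genA * genU * genA⁻¹ * genU * genA⁻¹
    else if δ = ((2, -2), 2) then
      (genU⁻¹ * genA * genU⁻¹ * genA * genU * genA⁻¹ * genU * genA⁻¹)⁻¹
    else edgeLetter δ

theorem edgeLetter_rev (δ : DirectedEdge) :
    edgeLetter (DirectedEdge.rev δ) = (edgeLetter δ)⁻¹ := by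
  obtain ⟨c, d⟩ := δ
  fin_cases d <;> simp [edgeLetter, DirectedEdge.rev]

theorem innerLabel_rev {k : Fin 5} {δ : DirectedEdge} (h : δ.1 ∈ baseTile k)
    (h' : δ.1 + dir δ.2 ∈ baseTile k) :
    innerLabel k (DirectedEdge.rev δ) = (innerLabel k δ)⁻¹ := by
  have hd : ∀ k, ∀ c ∈ baseTile k, ∀ d, c + dir d ∈ baseTile k →
      innerLabel k (c + dir d, d + 3) = (innerLabel k (c, d))⁻¹ := by
    decide +kernel
  exact hd k _ h _ h'

theorem innerLabel_eq_edgeLetter {k : Fin 5} {δ : DirectedEdge} (h : δ.1 ∈ baseTile k)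
    (h' : δ.1 + dir δ.2 ∉ baseTile k) : innerLabel k δ = edgeLetter δ := by
  have hd : ∀ k, ∀ c ∈ baseTile k, ∀ d, c + dir d ∉ baseTile k →
      innerLabel k (c, d) = edgeLetter (c, d) := by
    decide +kernel
  exact hd k _ h _ h'

/-- The winding invariants of the cells of the five tiles with the inner labels. -/
def innerWeight (k : Fin 5) (c : Cell) : ℤ :=
  (countingAction (pathWord (innerLabel k) (cellEdges c)) ((1, 1), 0)).2

/-- Going through the cells of a tile in order, the inner labels are solved for so that every cell
but the last has a trivial word. The last cell then carries the word of the whole tile; for `T₁` it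
is `(A⁻¹U)³` modulo `A³` and `U³`, a counterclockwise hexagon. -/
theorem innerLabel_cell {k : Fin 5} {c : Cell} (h : c ∈ baseTile k) :
    pathWord (innerLabel k) (cellEdges c) ∈ kagomeSubgroup ∧
      windingInvariant (pathWord (innerLabel k) (cellEdges c)) = innerWeight k c := by
  have hd : ∀ k, ∀ c ∈ baseTile k,
      countingAction (pathWord (innerLabel k) (cellEdges c)) ((1, 1), 0) =
        ((1, 1), innerWeight k c) := by
    decide +kernel
  exact windingInvariant_eq_of_countingAction (hd k c h)

theorem sum_innerWeight (k : Fin 5) : ∑ c ∈ baseTile k, innerWeight k c = tileWeight k := by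
  revert k
  decide +kernel

theorem pathWord_cellEdges_sub {l l' : DirectedEdge → FreeGroup Gen} {a c : Cell}
    (h : ∀ d, l (c, d) = l' (c - a, d)) :
    pathWord l (cellEdges c) = pathWord l' (cellEdges (c - a)) := by
  simp [pathWord, cellEdges, h]

/-- In a tiled plane, the winding invariant of a region made up of tiles is the sum of the winding
invariants of the tiles. -/
theorem exists_cell_weight {T : Set (Cell × Fin 5)} (hT : ∀ c, ∃! t, t ∈ T ∧ c ∈ tileCells t) :
    ∃ m : Cell → ℤ, (∀ t ∈ T, ∑ c ∈ tileCells t, m c = tileWeight t.2) ∧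
      ∀ C : Finset Cell, (∀ t ∈ T, ∀ c ∈ tileCells t, c ∈ C → tileCells t ⊆ C) →
        ∀ γ, IsOrientedBoundary γ C → boundaryWord γ ∈ kagomeSubgroup ∧
          windingInvariant (boundaryWord γ) = ∑ c ∈ C, m c := by
  choose t ht huniq using hT
  have hmem : ∀ c, c - (t c).1 ∈ baseTile (t c).2 := fun c => mem_translateCells.1 (ht c).2
  obtain ⟨l, hl⟩ : ∃ l : DirectedEdge → FreeGroup Gen,
      ∀ δ, l δ = innerLabel (t δ.1).2 (δ.1 - (t δ.1).1, δ.2) := ⟨_, fun _ => rfl⟩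
  have hcell : ∀ c, pathWord l (cellEdges c) =
      pathWord (innerLabel (t c).2) (cellEdges (c - (t c).1)) := fun c =>
    pathWord_cellEdges_sub fun d => hl (c, d)
  have hletter : ∀ δ, δ.1 + dir δ.2 ∉ tileCells (t δ.1) → l δ = edgeLetter δ := by
    intro δ h
    rw [hl, innerLabel_eq_edgeLetter (hmem δ.1)]
    · rfl
    · rwa [tileCells, mem_translateCells, add_sub_right_comm] at h
  have hflat : IsFlatLabelling l := by
    refine ⟨fun δ => ?_, fun c => ?_⟩
    · by_cases h : δ.1 + dir δ.2 ∈ tileCells (t δ.1)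
      · have e : t (DirectedEdge.rev δ).1 = t δ.1 :=
          (huniq (DirectedEdge.rev δ).1 (t δ.1) ⟨(ht δ.1).1, h⟩).symm
        rw [hl, hl, e, ← innerLabel_rev (hmem δ.1)]
        · simp only [DirectedEdge.rev, add_sub_right_comm]
        · rwa [tileCells, mem_translateCells, add_sub_right_comm] at h
      · rw [hletter δ h, hletter (DirectedEdge.rev δ), edgeLetter_rev]
        intro h'
        simp only [DirectedEdge.rev, dir_add_three, add_neg_cancel_right] at h'
        rw [← huniq δ.1 _ ⟨(ht _).1, h'⟩] at h
        exact h (ht _).2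
    · rw [hcell]; exact (innerLabel_cell (hmem c)).1
  refine ⟨fun c => windingInvariant (pathWord l (cellEdges c)), fun s hs => ?_,
    fun C hC γ hγ => windingInvariant_boundaryWord hflat (fun δ hδ => hletter δ fun h => ?_) hγ⟩
  · rw [← sum_innerWeight, tileCells, translateCells,
      Finset.sum_image (fun x _ y _ h => add_left_cancel h)]
    refine Finset.sum_congr rfl fun c hc => ?_
    have e : t (s.1 + c) = s :=
      (huniq _ s ⟨hs, mem_translateCells.2 (by rwa [add_sub_cancel_left])⟩).symm
    rw [hcell, e, add_sub_cancel_left, (innerLabel_cell hc).2]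
  · rw [mem_boundaryEdges] at hδ
    exact hδ.2 (hC _ (ht δ.1).1 _ (ht δ.1).2 hδ.1 h)

/-! ## The tiling of a ground state -/

/-- The tiles `S` form a tiling of `X`. -/
def TilesExactly (S : Finset (Cell × Fin 5)) (X : Finset Cell) : Prop :=
  (∀ t ∈ S, tileCells t ⊆ X) ∧
    ∀ c ∈ X, ∃ t ∈ S, c ∈ tileCells t ∧ ∀ t' ∈ S, c ∈ tileCells t' → t' = t

instance (S : Finset (Cell × Fin 5)) (X : Finset Cell) : Decidable (TilesExactly S X) := by
  unfold TilesExactly; infer_instance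

/-- The translates of the tiles in `S`. -/
def shiftTiles (a : Cell) (S : Finset (Cell × Fin 5)) : Finset (Cell × Fin 5) :=
  S.image fun t => (a + t.1, t.2)

theorem mem_tileCells_shift {a c : Cell} {t : Cell × Fin 5} :
    c ∈ tileCells (a + t.1, t.2) ↔ c - a ∈ tileCells t := by
  simp only [tileCells, mem_translateCells, sub_sub]

theorem TilesExactly.shift {S : Finset (Cell × Fin 5)} {X : Finset Cell} (h : TilesExactly S X)
    (a : Cell) : TilesExactly (shiftTiles a S) (translateCells a X) := by
  constructor
  · intro t ht c hc
    obtain ⟨t, ht', rfl⟩ := Finset.mem_image.1 ht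
    exact mem_translateCells.2 (h.1 t ht' (mem_tileCells_shift.1 hc))
  · intro c hc
    obtain ⟨t, h1, h2, h3⟩ := h.2 _ (mem_translateCells.1 hc)
    refine ⟨_, Finset.mem_image_of_mem _ h1, mem_tileCells_shift.2 h2, fun t' ht' hc' => ?_⟩
    obtain ⟨t', h4, rfl⟩ := Finset.mem_image.1 ht'
    rw [h3 t' h4 (mem_tileCells_shift.1 hc')]

theorem sum_shiftTiles (a : Cell) (S : Finset (Cell × Fin 5)) (f : Fin 5 → ℤ) :
    ∑ t ∈ shiftTiles a S, f t.2 = ∑ t ∈ S, f t.2 := by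
  rw [shiftTiles, Finset.sum_image]
  intro t _ t' _ h
  simp only [Prod.mk.injEq, add_right_inj] at h
  exact Prod.ext h.1 h.2

theorem TilesExactly.sum {S : Finset (Cell × Fin 5)} {X : Finset Cell} (h : TilesExactly S X)
    (m : Cell → ℤ) : ∑ c ∈ X, m c = ∑ t ∈ S, ∑ c ∈ tileCells t, m c := by
  have hX : X = S.biUnion tileCells := by
    ext c
    rw [Finset.mem_biUnion]
    constructor
    · intro hc
      obtain ⟨t, h1, h2, -⟩ := h.2 c hc
      exact ⟨t, h1, h2⟩
    · rintro ⟨t, h1, h2⟩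
      exact h.1 t h1 h2
  rw [hX, Finset.sum_biUnion]
  intro t ht t' ht' hne
  refine Finset.disjoint_left.2 fun c hc hc' => hne ?_
  obtain ⟨u, -, -, h3⟩ := h.2 c (h.1 t ht hc)
  rw [h3 t ht hc, h3 t' ht' hc']

/-- The tiles of a site at a corner of the plaquette with centre `0`, occupied or empty. -/
def siteBaseTiles : Sublat → Bool → Finset (Cell × Fin 5)
  | Sublat.A, true => {((0, 2), 0)}
  | Sublat.A, false => {((-1, 3), 2), ((1, 2), 1)}
  | Sublat.B, true => {((0, -2), 1)}
  | Sublat.B, false => {((-1, -3), 2), ((-1, -2), 0)}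

/-- The tiles of the middle region of the plaquette with centre `0`, two sites of which are
occupied. -/
def midTiles (b : Fin 6 → Bool) : Finset (Cell × Fin 5) :=
  if b 0 && b 1 then {((-1, 0), 0), ((0, -1), 2), ((1, 1), 1)}
  else if b 0 && b 2 then {((-1, 0), 0), ((-1, 2), 4), ((0, -1), 2)}
  else if b 0 && b 3 then {((-1, 1), 1), ((0, -1), 0), ((0, 1), 4)}
  else if b 0 && b 4 then {((-1, -1), 0), ((0, 1), 1), ((1, -1), 0)}
  else if b 0 && b 5 then {((-1, 0), 0), ((1, -1), 1), ((0, 1), 4)}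
  else if b 1 && b 2 then {((0, 0), 1), ((-1, 1), 0), ((1, -1), 3)}
  else if b 1 && b 3 then {((-1, 1), 1), ((0, -1), 0), ((1, 1), 1)}
  else if b 1 && b 4 then {((-1, -1), 0), ((0, 1), 1), ((1, -1), 3)}
  else if b 1 && b 5 then {((-1, 0), 0), ((1, -1), 1), ((1, 1), 1)}
  else if b 2 && b 3 then {((-1, 1), 1), ((-1, 2), 4), ((0, -1), 0)}
  else if b 2 && b 4 then {((-1, -1), 0), ((-1, 1), 0), ((1, 0), 1)}
  else if b 2 && b 5 then {((-1, 0), 0), ((-1, 2), 4), ((1, -1), 1)}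
  else if b 3 && b 4 then {((-1, 1), 1), ((-1, -1), 2), ((0, 0), 0)}
  else if b 3 && b 5 then {((-1, 1), 1), ((1, -1), 1), ((0, 0), 0)}
  else if b 4 && b 5 then {((-1, -1), 0), ((0, 1), 1), ((1, -2), 3)}
  else ∅

/-- The sign of the sublattice of a corner of a plaquette. -/
def cornerSign : Fin 6 → ℤ := ![-1, 1, -1, 1, -1, 1]

theorem sublatticeSign_cornerSite (p : Plaquette) (k : Fin 6) :
    sublatticeSign (cornerSite p k) = cornerSign k := by
  fin_cases k <;> rfl

/-- Here the filling enters, through a check of the fifteen pairs of occupied corners: two particles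
on `A` give invariant `-1`, two on `B` give `1`, and a mixed pair gives `0`. -/
theorem midTiles_spec (b : Fin 6 → Bool) (h : (Finset.univ.filter fun k => b k = true).card = 2) :
    TilesExactly (midTiles b) (midCells b) ∧
      2 * ∑ t ∈ midTiles b, tileWeight t.2 = -∑ k, if b k = true then cornerSign k else 0 := by
  revert b
  decide +kernel

theorem siteBaseTiles_spec (b : Bool) :
    TilesExactly (siteBaseTiles Sublat.A b) (cornerTile b 1) ∧
      TilesExactly (siteBaseTiles Sublat.B b) (cornerTile b 4) := by
  revert b
  decide +kernel

/-- The tiles of a piece of the plane. -/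
def pieceTiles (n : Config) : Site ⊕ Plaquette → Finset (Cell × Fin 5) :=
  Sum.elim (fun s => shiftTiles (plaquetteCentre s.2) (siteBaseTiles s.1 (n s)))
    (fun p => shiftTiles (plaquetteCentre p) (midTiles fun k => n (cornerSite p k)))

theorem isGroundState_iff (n : Config) : IsGroundState n ↔
    ∀ p, (Finset.univ.filter fun k => n (cornerSite p k) = true).card = 2 := by
  refine forall_congr' fun p => ?_
  rw [plaquetteSites_eq, Finset.filter_image,
    Finset.card_image_of_injective _ (cornerSite_injective p)]

theorem sum_plaquetteSites {M : Type*} [AddCommMonoid M] (p : Plaquette) (f : Site → M) :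
    ∑ s ∈ plaquetteSites p, f s = ∑ k, f (cornerSite p k) := by
  rw [plaquetteSites_eq, Finset.sum_image fun a _ b _ h => cornerSite_injective p h]

theorem tilesExactly_pieceTiles {n : Config} (hn : IsGroundState n) (r : Site ⊕ Plaquette) :
    TilesExactly (pieceTiles n r) (pieceCells n r) := by
  rcases r with ⟨S, p⟩ | p
  · cases S
    · have := siteTile_cornerSite n p 1
      rw [show cornerSite p 1 = (Sublat.A, p) from rfl] at this
      change TilesExactly _ (siteTile n _)
      rw [this]
      exact (siteBaseTiles_spec (n (Sublat.A, p))).1.shift (plaquetteCentre p)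
    · have := siteTile_cornerSite n p 4
      rw [show cornerSite p 4 = (Sublat.B, p) from rfl] at this
      change TilesExactly _ (siteTile n _)
      rw [this]
      exact (siteBaseTiles_spec (n (Sublat.B, p))).2.shift (plaquetteCentre p)
  · change TilesExactly _ (middleRegion n p)
    rw [middleRegion_eq]
    exact (midTiles_spec _ ((isGroundState_iff n).1 hn p)).1.shift (plaquetteCentre p)

/-- The winding invariant of a piece. -/
def pieceWeight (n : Config) (r : Site ⊕ Plaquette) : ℤ := ∑ t ∈ pieceTiles n r, tileWeight t.2

theorem pieceWeight_site (n : Config) (s : Site) : pieceWeight n (Sum.inl s) =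
    if n s = true then sublatticeSign s else -sublatticeSign s := by
  have : ∀ S b, ∑ t ∈ siteBaseTiles S b, tileWeight t.2 =
      if b = true then sublatticeSign (S, 0, 0) else -sublatticeSign (S, 0, 0) := by
    intro S b; cases S <;> revert b <;> decide
  obtain ⟨S, p⟩ := s
  exact (sum_shiftTiles _ _ _).trans (this S _)

theorem pieceWeight_plaquette {n : Config} (hn : IsGroundState n) (p : Plaquette) :
    2 * pieceWeight n (Sum.inr p) =
      -∑ s ∈ plaquetteSites p, if n s = true then sublatticeSign s else 0 := by
  simp only [sum_plaquetteSites, sublatticeSign_cornerSite]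
  rw [← (midTiles_spec _ ((isGroundState_iff n).1 hn p)).2, pieceWeight]
  exact congrArg _ (sum_shiftTiles _ _ _)

/-- The tiles of the plane. -/
def planeTiles (n : Config) : Set (Cell × Fin 5) := {t | ∃ r, t ∈ pieceTiles n r}

theorem existsUnique_planeTiles {n : Config} (hn : IsGroundState n) (c : Cell) :
    ∃! t, t ∈ planeTiles n ∧ c ∈ tileCells t := by
  obtain ⟨r, hr⟩ := exists_mem_pieceCells n c
  obtain ⟨t, h1, h2, h3⟩ := (tilesExactly_pieceTiles hn r).2 c hr
  refine ⟨t, ⟨⟨r, h1⟩, h2⟩, ?_⟩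
  rintro t' ⟨⟨r', h4⟩, h5⟩
  have := piece_eq_of_mem ((tilesExactly_pieceTiles hn r').1 t' h4 h5) hr
  exact h3 t' (this ▸ h4) h5

/-- Sites and plaquettes of a ground state are tiled compatibly. -/
theorem exists_tiling {n : Config} (hn : IsGroundState n) :
    ∃ 𝒯 : Set (Finset Cell), IsTiling 𝒯 Set.univ ∧
      (∀ s : Site, n s = true → particleTile s ∈ 𝒯) ∧
      (∀ s : Site, ∃ 𝒯' ⊆ 𝒯, IsTiling 𝒯' (siteTile n s)) ∧
      (∀ p : Plaquette, ∃ 𝒯' ⊆ 𝒯, IsTiling 𝒯' (middleRegion n p)) := by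
  have hdis : ∀ S ⊆ planeTiles n, (tileCells '' S).PairwiseDisjoint id := by
    rintro S hS _ ⟨t, ht, rfl⟩ _ ⟨t', ht', rfl⟩ hne
    refine Finset.disjoint_left.2 fun c hc hc' => hne ?_
    rw [(existsUnique_planeTiles hn c).unique ⟨hS ht, hc⟩ ⟨hS ht', hc'⟩]
  have htile : ∀ S : Set (Cell × Fin 5), ∀ t ∈ tileCells '' S, IsTile t := by
    rintro S _ ⟨t, -, rfl⟩; exact isTile_tileCells t
  have hpiece : ∀ r, ∃ 𝒯' ⊆ tileCells '' planeTiles n, IsTiling 𝒯' (pieceCells n r) := by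
    intro r
    have hsub : (pieceTiles n r : Set (Cell × Fin 5)) ⊆ planeTiles n := fun t ht => ⟨r, ht⟩
    refine ⟨tileCells '' pieceTiles n r, Set.image_mono hsub, htile _, hdis _ hsub, ?_⟩
    ext c
    simp only [Set.mem_iUnion, Set.mem_image, exists_prop, Finset.mem_coe]
    constructor
    · rintro ⟨_, ⟨t, ht, rfl⟩, hc⟩
      exact (tilesExactly_pieceTiles hn r).1 t ht hc
    · intro hc
      obtain ⟨t, h1, h2, -⟩ := (tilesExactly_pieceTiles hn r).2 c hc
      exact ⟨_, ⟨t, h1, rfl⟩, h2⟩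
  refine ⟨tileCells '' planeTiles n, ⟨htile _, hdis _ subset_rfl, ?_⟩, fun s hs => ?_,
    fun s => hpiece (Sum.inl s), fun p => hpiece (Sum.inr p)⟩
  · refine Set.eq_univ_of_forall fun c => ?_
    obtain ⟨t, ⟨h1, h2⟩, -⟩ := existsUnique_planeTiles hn c
    exact Set.mem_biUnion (Set.mem_image_of_mem _ h1) h2
  · have h := tilesExactly_pieceTiles hn (Sum.inl s)
    obtain ⟨t, ht⟩ : ∃ t, pieceTiles n (Sum.inl s) = {t} := by
      obtain ⟨S, p⟩ := s
      cases S <;> simp [pieceTiles, hs, siteBaseTiles, shiftTiles]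
    have hp : pieceCells n (Sum.inl s) = particleTile s := by simp [pieceCells, siteTile, hs]
    rw [ht, hp] at h
    refine ⟨t, ⟨Sum.inl s, by simp [ht]⟩, subset_antisymm (h.1 t (by simp)) fun c hc => ?_⟩
    obtain ⟨t', h1, h2, -⟩ := h.2 c hc
    rwa [Finset.mem_singleton.1 h1] at h2

/-! ## The winding invariants of the pieces and of unions of pieces -/

theorem hasBoundaryInvariant_of_forall {C : Finset Cell} {k : ℤ}
    (h : ∃ γ, IsOrientedBoundary γ C)
    (hk : ∀ γ, IsOrientedBoundary γ C →
      boundaryWord γ ∈ kagomeSubgroup ∧ windingInvariant (boundaryWord γ) = k) :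
    HasBoundaryInvariant C ∧ boundaryInvariant C = k := by
  have e : boundaryInvariant C = k := by
    unfold boundaryInvariant
    rw [dif_pos h]
    exact (hk _ h.choose_spec).2
  exact ⟨⟨h, fun γ hγ => by rw [e]; exact hk γ hγ⟩, e⟩

/-- No tile of the plane crosses from one piece into another, so a union of pieces is a union of
tiles and its invariant is the sum over the pieces. Connectedness matters only through the existence
of an oriented boundary. -/
theorem boundaryInvariant_biUnion_pieceCells {n : Config} (hn : IsGroundState n)
    (D : Finset (Site ⊕ Plaquette)) (h : ∃ γ, IsOrientedBoundary γ (D.biUnion (pieceCells n))) :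
    HasBoundaryInvariant (D.biUnion (pieceCells n)) ∧
      boundaryInvariant (D.biUnion (pieceCells n)) = ∑ r ∈ D, pieceWeight n r := by
  obtain ⟨m, hm, hC⟩ := exists_cell_weight (existsUnique_planeTiles hn)
  have hsum : ∑ c ∈ D.biUnion (pieceCells n), m c = ∑ r ∈ D, pieceWeight n r := by
    rw [Finset.sum_biUnion]
    · refine Finset.sum_congr rfl fun r _ => ?_
      rw [(tilesExactly_pieceTiles hn r).sum]
      exact Finset.sum_congr rfl fun t ht => hm t ⟨r, ht⟩
    · intro r _ r' _ hne
      exact Finset.disjoint_left.2 fun c hc hc' => hne (piece_eq_of_mem hc hc')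
  refine hasBoundaryInvariant_of_forall h fun γ hγ => ?_
  rw [← hsum]
  refine hC _ ?_ γ hγ
  rintro t ⟨r, ht⟩ c hc hcD
  obtain ⟨r', h1, h2⟩ := Finset.mem_biUnion.1 hcD
  have hr := (tilesExactly_pieceTiles hn r).1 t ht
  rw [piece_eq_of_mem h2 (hr hc)] at h1
  exact hr.trans (Finset.subset_biUnion_of_mem (pieceCells n) h1)

/-! ### The invariants of single site tiles -/

/-- A translate of a directed edge. -/
def DirectedEdge.shift (a : Cell) (δ : DirectedEdge) : DirectedEdge := (a + δ.1, δ.2)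

theorem IsOrientedBoundary.translate {γ : List DirectedEdge} {C : Finset Cell}
    (h : IsOrientedBoundary γ C) (a : Cell) :
    IsOrientedBoundary (γ.map (DirectedEdge.shift a)) (translateCells a C) := by
  obtain ⟨h1, h2, h3, h4⟩ := h
  refine ⟨by simpa using h1, h2.map fun δ ε hδε => ?_, fun δ => ?_, ?_⟩
  · simp only [DirectedEdge.shift, Prod.mk.injEq, add_right_inj] at hδε
    exact Prod.ext hδε.1 hδε.2
  · rw [mem_translateCells, mem_translateCells, add_sub_right_comm,
      ← h3 (δ.1 - a, δ.2), List.mem_map]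
    constructor
    · rintro ⟨ε, hε, rfl⟩; simpa [DirectedEdge.shift] using hε
    · intro hδ; exact ⟨_, hδ, by simp [DirectedEdge.shift]⟩
  · have ht : DirectedEdge.target ∘ DirectedEdge.shift a = (3 • a + ·) ∘ DirectedEdge.target := by
      funext δ
      simp [DirectedEdge.target, DirectedEdge.shift, smul_add, add_assoc]
    have hs : DirectedEdge.source ∘ DirectedEdge.shift a = (3 • a + ·) ∘ DirectedEdge.source := by
      funext δ
      simp [DirectedEdge.source, DirectedEdge.shift, smul_add, add_assoc]
    rw [List.map_map, List.map_map, ht, hs, ← List.map_map, h4, List.map_rotate, List.map_map]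

theorem exists_isOrientedBoundary_siteTile (n : Config) (s : Site) :
    ∃ γ, IsOrientedBoundary γ (siteTile n s) := by
  -- The outward side of the cell `3 • dir k` is on the boundary for both kinds of tile. Following
  -- `nextEdge` from it for as many steps as there are boundary sides exhausts them.
  have hd : ∀ b k, ∃ γ, γ = List.iterate (nextEdge (cornerTile b k)) (dir k + dir k + dir k, k)
      (boundaryEdges (cornerTile b k)).card ∧ γ ≠ [] ∧ γ.Nodup ∧
      γ.toFinset = boundaryEdges (cornerTile b k) ∧
      γ.map DirectedEdge.target = (γ.map DirectedEdge.source).rotate 1 := by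
    simp only [exists_eq_left]
    decide +kernel
  obtain ⟨k, -, hk⟩ := exists_eq_cornerSite s
  obtain ⟨γ, -, h1, h2, h3, h4⟩ := hd (n s) k
  have : IsOrientedBoundary γ (cornerTile (n s) k) := by
    refine ⟨h1, h2, fun δ => ?_, h4⟩
    rw [← List.mem_toFinset, h3, mem_boundaryEdges]
  have e : siteTile n s = translateCells (plaquetteCentre s.2) (cornerTile (n s) k) := by
    conv_lhs => rw [hk, siteTile_cornerSite]
    rw [← hk]
  rw [e]
  exact ⟨_, this.translate _⟩

theorem boundaryInvariant_siteTile {n : Config} (hn : IsGroundState n) (s : Site) :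
    HasBoundaryInvariant (siteTile n s) ∧ boundaryInvariant (siteTile n s) =
      if n s = true then sublatticeSign s else -sublatticeSign s := by
  have := boundaryInvariant_biUnion_pieceCells hn {Sum.inl s}
  rw [Finset.singleton_biUnion, Finset.sum_singleton, pieceWeight_site] at this
  exact this (exists_isOrientedBoundary_siteTile n s)

/-- One sublattice is left empty and the other is filled on two of the three classes of `x - y`
modulo 3. The three sites of that sublattice on a plaquette represent all three classes. Such a
state exhibits any particle tile as a site tile, whose invariant is known. -/
theorem exists_isGroundState_occupied (s : Site) : ∃ n, IsGroundState n ∧ n s = true := by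
  obtain ⟨S, i, j⟩ := s
  refine ⟨fun t => decide (t.1 = S ∧ (t.2.1 - t.2.2 - i + j) % 3 ≠ 1), ?_, by simp⟩
  rw [isGroundState_iff]
  rintro ⟨x, y⟩
  rw [Finset.card_filter, Fin.sum_univ_six]
  have h3 : (x - y - i + j) % 3 = 0 ∨ (x - y - i + j) % 3 = 1 ∨ (x - y - i + j) % 3 = 2 := by omega
  have e1 : (x + 1 - y - i + j) % 3 = ((x - y - i + j) % 3 + 1) % 3 := by omega
  have e2 : (x - 1 - y - i + j) % 3 = ((x - y - i + j) % 3 + 2) % 3 := by omega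
  have e3 : (x - (y + 1) - i + j) % 3 = ((x - y - i + j) % 3 + 2) % 3 := by omega
  have e4 : (x - (y - 1) - i + j) % 3 = ((x - y - i + j) % 3 + 1) % 3 := by omega
  cases S <;> rcases h3 with h3 | h3 | h3 <;>
    simp [cornerSite, e1, e2, e3, e4, h3]

theorem boundaryInvariant_particleTile (s : Site) :
    HasBoundaryInvariant (particleTile s) ∧
      boundaryInvariant (particleTile s) = sublatticeSign s := by
  obtain ⟨n, hn, hs⟩ := exists_isGroundState_occupied s
  have := boundaryInvariant_siteTile hn s
  simpa [siteTile, hs] using this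

/-! ## The sublattice imbalance in terms of boundary data -/

/-- The plaquettes of a site. -/
def sitePlaquettes : Site → Finset Plaquette
  | (Sublat.A, p) => {p, p + (1, 0), p + (0, 1)}
  | (Sublat.B, p) => {p, p - (1, 0), p - (0, 1)}

theorem mem_sitePlaquettes {s : Site} {p : Plaquette} :
    p ∈ sitePlaquettes s ↔ s ∈ plaquetteSites p := by
  obtain ⟨S, i, j⟩ := s
  obtain ⟨x, y⟩ := p
  cases S <;> simp [sitePlaquettes, plaquetteSites, Prod.ext_iff] <;> omega

theorem card_sitePlaquettes_le (s : Site) : (sitePlaquettes s).card ≤ 3 := by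
  obtain ⟨S, p⟩ := s
  cases S <;> exact Finset.card_le_three

theorem filter_subset_sitePlaquettes (R : Finset Plaquette) (s : Site) :
    (R.filter fun p => s ∈ plaquetteSites p) ⊆ sitePlaquettes s := fun _ hp =>
  mem_sitePlaquettes.2 (Finset.mem_filter.1 hp).2

theorem mem_regionSites {R : Finset Plaquette} {s : Site} :
    s ∈ regionSites R ↔ ∃ p ∈ R, s ∈ plaquetteSites p := by
  simp [regionSites]

theorem degree_cases {R : Finset Plaquette} {s : Site} (hs : s ∈ regionSites R) :
    (R.filter fun p => s ∈ plaquetteSites p).card = 1 ∨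
    (R.filter fun p => s ∈ plaquetteSites p).card = 2 ∨
    (R.filter fun p => s ∈ plaquetteSites p).card = 3 := by
  have h1 := (Finset.card_le_card (filter_subset_sitePlaquettes R s)).trans
    (card_sitePlaquettes_le s)
  obtain ⟨p, hp, hsp⟩ := mem_regionSites.1 hs
  have h2 : 0 < (R.filter fun p => s ∈ plaquetteSites p).card :=
    Finset.card_pos.2 ⟨p, Finset.mem_filter.2 ⟨hp, hsp⟩⟩
  omega

theorem mem_of_degree_eq_three {R : Finset Plaquette} {s : Site}
    (h : (R.filter fun p => s ∈ plaquetteSites p).card = 3) {p : Plaquette}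
    (hp : s ∈ plaquetteSites p) : p ∈ R := by
  have e := Finset.eq_of_subset_of_card_le (filter_subset_sitePlaquettes R s)
    (by rw [h]; exact card_sitePlaquettes_le s)
  have := mem_sitePlaquettes.2 hp
  rw [← e] at this
  exact (Finset.mem_filter.1 this).1

theorem sum_cornerSign : ∑ k, cornerSign k = 0 := by decide

theorem sum_sum_plaquetteSites (R : Finset Plaquette) (f : Site → ℚ) :
    ∑ p ∈ R, ∑ s ∈ plaquetteSites p, f s =
      ∑ s ∈ regionSites R, ((R.filter fun p => s ∈ plaquetteSites p).card : ℚ) * f s := by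
  rw [Finset.sum_comm' (t' := regionSites R) (s' := fun s => R.filter fun p => s ∈ plaquetteSites p)]
  · simp [Finset.sum_const, nsmul_eq_mul]
  · intro p s
    rw [Finset.mem_filter, mem_regionSites]
    exact ⟨fun h => ⟨h, p, h⟩, fun h => h.1⟩

theorem sum_sitesOfDegree (R : Finset Plaquette) (k : ℕ) (f : Site → ℚ) :
    ∑ s ∈ sitesOfDegree R k, f s = ∑ s ∈ regionSites R,
      (if (R.filter fun p => s ∈ plaquetteSites p).card = k then f s else 0) := by
  rw [sitesOfDegree, Finset.sum_filter]

theorem polarization_eq {n : Config} (hn : IsGroundState n) {R : Finset Plaquette}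
    (hR : IsSimplyConnectedRegion (tiledRegion n R)) :
    HasBoundaryInvariant (tiledRegion n R) ∧
      (1 / 2 : ℚ) * (polarization (regionSites R) n : ℚ) =
        (boundaryInvariant (tiledRegion n R) : ℚ)
        - (2 / 3 : ℚ) * ∑ s ∈ sitesOfDegree R 1,
            ((siteInvariant n s : ℚ) - (1 / 2 : ℚ) * (particleInvariant n s : ℚ))
        - (1 / 3 : ℚ) * ∑ s ∈ sitesOfDegree R 2,
            ((siteInvariant n s : ℚ) - (1 / 2 : ℚ) * (particleInvariant n s : ℚ)) := by
  have hB := boundaryInvariant_biUnion_pieceCells hn (regionPieces R)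
    (tiledRegion_eq_biUnion n R ▸ hR.exists_isOrientedBoundary)
  rw [← tiledRegion_eq_biUnion, regionPieces, Finset.sum_disjSum] at hB
  refine ⟨hB.1, ?_⟩
  obtain ⟨a, ha⟩ : ∃ a : Site → ℚ, ∀ s, a s = if n s = true then (sublatticeSign s : ℚ) else 0 :=
    ⟨_, fun _ => rfl⟩
  -- The combination `φ_i - ½ φ_{i,M}` in closed form: `ε/2` at a particle, `-ε` at a hole.
  obtain ⟨v, hv⟩ : ∃ v : Site → ℚ, ∀ s, v s = 3 / 2 * a s - sublatticeSign s := ⟨_, fun _ => rfl⟩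
  have hsite : ∀ s, (siteInvariant n s : ℚ) - (1 / 2 : ℚ) * (particleInvariant n s : ℚ) = v s := by
    intro s
    rw [siteInvariant, particleInvariant, (boundaryInvariant_siteTile hn s).2,
      (boundaryInvariant_particleTile s).2, hv, ha]
    split_ifs <;> push_cast <;> ring
  have hW : ∀ s, (pieceWeight n (Sum.inl s) : ℚ) = v s + 1 / 2 * a s := by
    intro s
    rw [pieceWeight_site, hv, ha]
    split_ifs <;> push_cast <;> ring
  have hM : ∀ p, (pieceWeight n (Sum.inr p) : ℚ) = -(1 / 3) * ∑ s ∈ plaquetteSites p, v s := by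
    intro p
    -- The three sites of each sublattice cancel, which allows the signs `ε` inside `v` to be added
    -- to the sum at no cost.
    have h1 : ∑ s ∈ plaquetteSites p, (sublatticeSign s : ℚ) = 0 := by
      rw [sum_plaquetteSites]
      simp only [sublatticeSign_cornerSite]
      exact_mod_cast sum_cornerSign
    have h2 : (2 : ℚ) * pieceWeight n (Sum.inr p) = -∑ s ∈ plaquetteSites p, a s := by
      have := congrArg (Int.cast : ℤ → ℚ) (pieceWeight_plaquette hn p)
      push_cast at this
      simpa only [ha] using this
    simp only [hv, Finset.sum_sub_distrib, ← Finset.mul_sum, h1]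
    linarith
  have hpol : (polarization (regionSites R) n : ℚ) = ∑ s ∈ regionSites R, a s := by
    simp only [polarization, ha]
    push_cast
    rfl
  rw [hB.2, hpol]
  push_cast
  simp only [hsite, hW, hM, ← Finset.mul_sum, sum_sum_plaquetteSites, sum_sitesOfDegree]
  simp only [Finset.mul_sum, ← Finset.sum_add_distrib, ← Finset.sum_sub_distrib]
  refine Finset.sum_congr rfl fun s hs => ?_
  -- A site on `d` plaquettes of `R` contributes `v + a/2 - (d/3) v`. The part `(1 - d/3) v` is
  -- removed by the coefficients `2/3`, `1/3` and, for interior sites, `0`.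
  rcases degree_cases hs with h | h | h <;> rw [h] <;> norm_num <;> ring

/-- The tile of an interior site lies inside the plaquettes of `R`, whatever its occupation. Hence
the shape of the region depends only on `S₁ ∪ S₂`. -/
theorem tiledRegion_eq_union (n : Config) (R : Finset Plaquette) :
    tiledRegion n R = R.biUnion plaquetteCells ∪
      (sitesOfDegree R 1 ∪ sitesOfDegree R 2).biUnion (siteTile n) := by
  ext c
  constructor
  · intro hc
    rw [tiledRegion, Finset.mem_union, Finset.mem_biUnion, Finset.mem_biUnion] at hc
    rw [Finset.mem_union, Finset.mem_biUnion, Finset.mem_biUnion]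
    rcases hc with ⟨p, hp, h⟩ | ⟨s, hs, h⟩
    · exact Or.inl ⟨p, hp, middleRegion_subset n p h⟩
    · rcases degree_cases hs with h1 | h1 | h1
      · exact Or.inr ⟨s, Finset.mem_union_left _ (Finset.mem_filter.2 ⟨hs, h1⟩), h⟩
      · exact Or.inr ⟨s, Finset.mem_union_right _ (Finset.mem_filter.2 ⟨hs, h1⟩), h⟩
      · obtain ⟨p, hp⟩ := exists_mem_plaquetteCells c
        exact Or.inl ⟨p, mem_of_degree_eq_three h1 (mem_plaquetteSites_of_mem_holeTile
          (siteTile_subset_holeTile n s h) hp), hp⟩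
  · intro hc
    rcases Finset.mem_union.1 hc with h | h
    · obtain ⟨p, hp, h⟩ := Finset.mem_biUnion.1 h
      exact plaquetteCells_subset_tiledRegion n hp h
    · obtain ⟨s, hs, h⟩ := Finset.mem_biUnion.1 h
      refine siteTile_subset_tiledRegion n ?_ h
      rcases Finset.mem_union.1 hs with h' | h' <;> exact (Finset.mem_filter.1 h').1

theorem siteTile_congr {n n' : Config} {s : Site} (h : n' s = n s) :
    siteTile n' s = siteTile n s := by
  simp only [siteTile, h]

theorem tiledRegion_congr {n n' : Config} {R : Finset Plaquette}
    (h : ∀ s ∈ sitesOfDegree R 1 ∪ sitesOfDegree R 2, n' s = n s) :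
    tiledRegion n' R = tiledRegion n R := by
  rw [tiledRegion_eq_union, tiledRegion_eq_union,
    Finset.biUnion_congr rfl fun s hs => siteTile_congr (h s hs)]

/-- The boundary configuration determines the sublattice imbalance of a region. -/
theorem polarization_congr {n n' : Config} (hn : IsGroundState n) (hn' : IsGroundState n')
    {R : Finset Plaquette} (hR : IsSimplyConnectedRegion (tiledRegion n R))
    (h : ∀ s ∈ sitesOfDegree R 1 ∪ sitesOfDegree R 2, n' s = n s) :
    polarization (regionSites R) n' = polarization (regionSites R) n := by
  -- Every term on the right of `polarization_eq` is determined by the set of cells and by the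
  -- occupations on `S₁ ∪ S₂`.
  have e := tiledRegion_congr h
  have h1 := (polarization_eq hn hR).2
  have h2 := (polarization_eq hn' (e ▸ hR)).2
  have hs : ∀ s ∈ sitesOfDegree R 1 ∪ sitesOfDegree R 2,
      (siteInvariant n' s : ℚ) - (1 / 2 : ℚ) * (particleInvariant n' s : ℚ) =
        (siteInvariant n s : ℚ) - (1 / 2 : ℚ) * (particleInvariant n s : ℚ) := by
    intro s hs
    simp only [siteInvariant, particleInvariant, siteTile_congr (h s hs), h s hs]
  rw [e, Finset.sum_congr rfl fun s hs' => hs s (Finset.mem_union_left _ hs'),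
    Finset.sum_congr rfl fun s hs' => hs s (Finset.mem_union_right _ hs'), ← h1] at h2
  have : (polarization (regionSites R) n' : ℚ) = polarization (regionSites R) n := by linarith
  exact_mod_cast this

/-! ## Parallelograms -/

/-- A parallelogram of plaquettes. -/
noncomputable def boxPlaquettes (N : ℤ) : Finset Plaquette := Finset.Icc (-N) N ×ˢ Finset.Icc (-N) N

theorem mem_boxPlaquettes {N : ℤ} {p : Plaquette} :
    p ∈ boxPlaquettes N ↔ (-N ≤ p.1 ∧ p.1 ≤ N) ∧ -N ≤ p.2 ∧ p.2 ≤ N := by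
  simp [boxPlaquettes]

theorem plaquetteGraph_adj_of_mem {X : Set Site} {s : Site} (hs : s ∈ X) {p q : Plaquette}
    (hp : p ∈ sitePlaquettes s) (hq : q ∈ sitePlaquettes s) (hpq : p ≠ q) :
    (plaquetteGraph X).Adj p q := by
  rw [plaquetteGraph, SimpleGraph.fromRel_adj]
  exact ⟨hpq, Or.inl ⟨s, hs, mem_sitePlaquettes.1 hp, mem_sitePlaquettes.1 hq⟩⟩

theorem joined_boxPlaquettes {N : ℤ} (k : ℕ) (x y : ℤ) (hx : -N ≤ x ∧ x ≤ N)
    (hy : -N ≤ y ∧ y ≤ N) (hk : x + N + (y + N) = k) :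
    JoinedWithin (plaquetteGraph Set.univ) (boxPlaquettes N : Set Plaquette) (x, y) (-N, -N) := by
  have hmem : ∀ a b : ℤ, (-N ≤ a ∧ a ≤ N) → (-N ≤ b ∧ b ≤ N) →
      (a, b) ∈ (boxPlaquettes N : Set Plaquette) := fun a b h1 h2 => mem_boxPlaquettes.2 ⟨h1, h2⟩
  induction k generalizing x y with
  | zero =>
    obtain rfl : x = -N := by omega
    obtain rfl : y = -N := by omega
    exact .refl (hmem _ _ hx hy)
  | succ k ih =>
    by_cases h : -N < x
    · refine (JoinedWithin.of_adj (hmem _ _ hx hy) (hmem (x - 1) y (by omega) hy) ?_).trans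
        (ih (x - 1) y (by omega) hy (by push_cast at hk; omega))
      exact plaquetteGraph_adj_of_mem (s := (Sublat.A, (x - 1, y))) (Set.mem_univ _)
        (by simp [sitePlaquettes]) (by simp [sitePlaquettes]) (by simp; omega)
    · refine (JoinedWithin.of_adj (hmem _ _ hx hy) (hmem x (y - 1) hx (by omega)) ?_).trans
        (ih x (y - 1) hx (by omega) (by push_cast at hk; omega))
      exact plaquetteGraph_adj_of_mem (s := (Sublat.A, (x, y - 1))) (Set.mem_univ _)
        (by simp [sitePlaquettes]) (by simp [sitePlaquettes]) (by simp; omega)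

theorem not_mem_regionSites {R : Finset Plaquette} {s : Site}
    (h : ∀ p ∈ sitePlaquettes s, p ∉ R) : s ∈ (regionSites R : Set Site)ᶜ := by
  intro hs
  obtain ⟨p, hp, hsp⟩ := mem_regionSites.1 hs
  exact h p (mem_sitePlaquettes.2 hsp) hp

/-- Increasing a coordinate preserves the condition `N < x ∨ N < y`. The `A` site with index `(x,
y)` joins `(x, y)` to its two successors, so none of its plaquettes is in the box; on the opposite
side the `B` sites do the same for decreasing coordinates. -/
theorem joined_compl_boxPlaquettes_up {N : ℤ} (a b : ℕ) (x y : ℤ) (h : N < x ∨ N < y) :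
    JoinedWithin (plaquetteGraph (regionSites (boxPlaquettes N) : Set Site)ᶜ)
      (boxPlaquettes N : Set Plaquette)ᶜ (x, y) (x + a, y + b) := by
  have hmem : ∀ a b : ℤ, (N < a ∨ N < b) → (a, b) ∈ (boxPlaquettes N : Set Plaquette)ᶜ := by
    intro a b h hm
    have := mem_boxPlaquettes.1 hm
    omega
  have hX : ∀ x y : ℤ, (N < x ∨ N < y) →
      (Sublat.A, (x, y)) ∈ (regionSites (boxPlaquettes N) : Set Site)ᶜ := by
    intro x y h
    refine not_mem_regionSites fun p hp => ?_
    simp only [sitePlaquettes, Finset.mem_insert, Finset.mem_singleton] at hp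
    rcases hp with rfl | rfl | rfl <;> exact hmem _ _ (by omega)
  have h1 : JoinedWithin (plaquetteGraph (regionSites (boxPlaquettes N) : Set Site)ᶜ)
      (boxPlaquettes N : Set Plaquette)ᶜ (x, y) (x + a, y) := by
    induction a with
    | zero => simpa using .refl (hmem x y h)
    | succ a ih =>
      refine ih.trans (.of_adj (hmem _ _ (by omega)) (hmem _ _ (by push_cast; omega)) ?_)
      exact plaquetteGraph_adj_of_mem (hX (x + a) y (by omega))
        (by simp [sitePlaquettes]) (by simp [sitePlaquettes, add_assoc]) (by simp)
  refine h1.trans ?_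
  induction b with
  | zero => simpa using .refl (hmem (x + a) y (by omega))
  | succ b ih =>
    refine ih.trans (.of_adj (hmem _ _ (by omega)) (hmem _ _ (by push_cast; omega)) ?_)
    exact plaquetteGraph_adj_of_mem (hX (x + a) (y + b) (by omega))
      (by simp [sitePlaquettes]) (by simp [sitePlaquettes, add_assoc]) (by simp)

theorem joined_compl_boxPlaquettes_down {N : ℤ} (a b : ℕ) (x y : ℤ) (h : x < -N ∨ y < -N) :
    JoinedWithin (plaquetteGraph (regionSites (boxPlaquettes N) : Set Site)ᶜ)
      (boxPlaquettes N : Set Plaquette)ᶜ (x, y) (x - a, y - b) := by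
  have hmem : ∀ a b : ℤ, (a < -N ∨ b < -N) → (a, b) ∈ (boxPlaquettes N : Set Plaquette)ᶜ := by
    intro a b h hm
    have := mem_boxPlaquettes.1 hm
    omega
  have hX : ∀ x y : ℤ, (x < -N ∨ y < -N) →
      (Sublat.B, (x, y)) ∈ (regionSites (boxPlaquettes N) : Set Site)ᶜ := by
    intro x y h
    refine not_mem_regionSites fun p hp => ?_
    simp only [sitePlaquettes, Finset.mem_insert, Finset.mem_singleton] at hp
    rcases hp with rfl | rfl | rfl <;> exact hmem _ _ (by omega)
  have h1 : JoinedWithin (plaquetteGraph (regionSites (boxPlaquettes N) : Set Site)ᶜ)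
      (boxPlaquettes N : Set Plaquette)ᶜ (x, y) (x - a, y) := by
    induction a with
    | zero => simpa using .refl (hmem x y h)
    | succ a ih =>
      refine ih.trans (.of_adj (hmem _ _ (by omega)) (hmem _ _ (by push_cast; omega)) ?_)
      exact plaquetteGraph_adj_of_mem (hX (x - a) y (by omega))
        (by simp [sitePlaquettes]) (by simp [sitePlaquettes, sub_sub]) (by simp)
  refine h1.trans ?_
  induction b with
  | zero => simpa using .refl (hmem (x - a) y (by omega))
  | succ b ih =>
    refine ih.trans (.of_adj (hmem _ _ (by omega)) (hmem _ _ (by push_cast; omega)) ?_)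
    exact plaquetteGraph_adj_of_mem (hX (x - a) (y - b) (by omega))
      (by simp [sitePlaquettes]) (by simp [sitePlaquettes, sub_sub]) (by simp)

theorem isPlaquetteDisc_boxPlaquettes {N : ℤ} (hN : 0 ≤ N) : IsPlaquetteDisc (boxPlaquettes N) := by
  constructor
  · have h : ∀ p ∈ boxPlaquettes N, JoinedWithin (plaquetteGraph Set.univ)
        (boxPlaquettes N : Set Plaquette) p (-N, -N) := by
      rintro ⟨x, y⟩ hp
      obtain ⟨h1, h2⟩ := mem_boxPlaquettes.1 hp
      simp only at h1 h2
      exact joined_boxPlaquettes (x + N + (y + N)).toNat x y h1 h2 (by omega)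
    refine JoinedWithin.connected ⟨(0, 0), mem_boxPlaquettes.2 (by simp [hN])⟩ fun p hp q hq => ?_
    exact (h p hp).trans (h q hq).symm
  -- The plaquette `(N + 1, -N - 1)` lies both in the upper and in the lower part of the complement.
  -- Within each part, it and `p` are joined through their coordinatewise maximum or minimum.
  · have h : ∀ p ∉ boxPlaquettes N,
        JoinedWithin (plaquetteGraph (regionSites (boxPlaquettes N) : Set Site)ᶜ)
          (boxPlaquettes N : Set Plaquette)ᶜ p (N + 1, -N - 1) := by
      rintro ⟨x, y⟩ hp
      rw [mem_boxPlaquettes] at hp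
      simp only at hp
      by_cases hu : N < x ∨ N < y
      · have h1 := joined_compl_boxPlaquettes_up (max x (N + 1) - x).toNat
          (max y (-N - 1) - y).toNat x y hu
        have h2 := joined_compl_boxPlaquettes_up (N := N) (max x (N + 1) - (N + 1)).toNat
          (max y (-N - 1) - (-N - 1)).toNat (N + 1) (-N - 1) (by omega)
        rw [show x + ((max x (N + 1) - x).toNat : ℤ) = max x (N + 1) by omega,
          show y + ((max y (-N - 1) - y).toNat : ℤ) = max y (-N - 1) by omega] at h1
        rw [show N + 1 + ((max x (N + 1) - (N + 1)).toNat : ℤ) = max x (N + 1) by omega,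
          show -N - 1 + ((max y (-N - 1) - (-N - 1)).toNat : ℤ) = max y (-N - 1) by omega] at h2
        exact h1.trans h2.symm
      · have h1 := joined_compl_boxPlaquettes_down (N := N) (x - min x (N + 1)).toNat
          (y - min y (-N - 1)).toNat x y (by omega)
        have h2 := joined_compl_boxPlaquettes_down (N := N) (N + 1 - min x (N + 1)).toNat
          (-N - 1 - min y (-N - 1)).toNat (N + 1) (-N - 1) (by omega)
        rw [show x - ((x - min x (N + 1)).toNat : ℤ) = min x (N + 1) by omega,
          show y - ((y - min y (-N - 1)).toNat : ℤ) = min y (-N - 1) by omega] at h1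
        rw [show N + 1 - ((N + 1 - min x (N + 1)).toNat : ℤ) = min x (N + 1) by omega,
          show -N - 1 - ((-N - 1 - min y (-N - 1)).toNat : ℤ) = min y (-N - 1) by omega] at h2
        exact h1.trans h2.symm
    refine JoinedWithin.connected ⟨(N + 1, 0), fun hm => ?_⟩ fun p hp q hq =>
      (h p hp).trans (h q hq).symm
    have := mem_boxPlaquettes.1 hm
    omega

theorem exists_box_interior (Λ : Finset Site) : ∃ N : ℤ, 0 ≤ N ∧
    ∀ s ∈ Λ, ∀ p ∈ sitePlaquettes s, p ∈ boxPlaquettes N := by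
  obtain ⟨M, hM⟩ : ∃ M : ℕ, ∀ s ∈ Λ, s.2.1.natAbs + s.2.2.natAbs ≤ M :=
    ⟨∑ s ∈ Λ, (s.2.1.natAbs + s.2.2.natAbs), fun s hs =>
      Finset.single_le_sum (f := fun s : Site => s.2.1.natAbs + s.2.2.natAbs)
        (fun _ _ => Nat.zero_le _) hs⟩
  refine ⟨M + 1, by omega, ?_⟩
  rintro ⟨S, x, y⟩ hs p hp
  have h := hM _ hs
  simp only at h
  rw [mem_boxPlaquettes]
  cases S <;> simp only [sitePlaquettes, Finset.mem_insert, Finset.mem_singleton] at hp <;>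
    rcases hp with rfl | rfl | rfl <;> simp <;> omega

/-- Ground states that differ on finitely many sites have the same imbalance. -/
theorem polarization_eq_of_eq_outside {n n' : Config} (hn : IsGroundState n)
    (hn' : IsGroundState n') {Λ : Finset Site} (h : ∀ s, s ∉ Λ → n' s = n s) :
    polarization Λ n' = polarization Λ n := by
  obtain ⟨N, hN, hΛ⟩ := exists_box_interior Λ
  have hself : ∀ s : Site, s.2 ∈ sitePlaquettes s := by
    rintro ⟨S, p⟩; cases S <;> simp [sitePlaquettes]
  have hcard : ∀ s : Site, (sitePlaquettes s).card = 3 := by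
    rintro ⟨S, i, j⟩
    cases S <;> exact Finset.card_eq_three.2 ⟨_, _, _, by simp <;> omega, by simp <;> omega, by simp, rfl⟩
  -- The box contains all three plaquettes of each site of `Λ`, so the sites of `S₁ ∪ S₂` lie
  -- outside `Λ` and the two states agree there.
  have hdeg : ∀ s ∈ Λ, ((boxPlaquettes N).filter fun p => s ∈ plaquetteSites p).card = 3 := by
    intro s hs
    rw [← hcard s]
    congr 1
    refine subset_antisymm (filter_subset_sitePlaquettes _ s) fun p hp => ?_
    exact Finset.mem_filter.2 ⟨hΛ s hs p hp, mem_sitePlaquettes.1 hp⟩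
  have hsub : Λ ⊆ regionSites (boxPlaquettes N) := fun s hs =>
    mem_regionSites.2 ⟨s.2, hΛ s hs _ (hself s), mem_sitePlaquettes.1 (hself s)⟩
  have hbd : ∀ s ∈ sitesOfDegree (boxPlaquettes N) 1 ∪ sitesOfDegree (boxPlaquettes N) 2,
      n' s = n s := by
    intro s hs
    refine h s fun hsΛ => ?_
    have h3 := hdeg s hsΛ
    rcases Finset.mem_union.1 hs with h' | h'
    · have := (Finset.mem_filter.1 h').2; omega
    · have := (Finset.mem_filter.1 h').2; omega
  have key := polarization_congr hn hn'
    ((isPlaquetteDisc_boxPlaquettes hN).isSimplyConnectedRegion n) hbd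
  unfold polarization at key ⊢
  -- The sites of the box outside `Λ` contribute equally to both imbalances and cancel.
  rw [← Finset.sum_sdiff hsub, ← Finset.sum_sdiff hsub (f := fun s => if n s = true then _ else _),
    Finset.sum_congr rfl fun s hs => by rw [h s (Finset.mem_sdiff.1 hs).2]] at key
  exact add_left_cancel key

/-! ## Local operators -/

theorem polarizationOperator_single (Λ : Finset Site) (n : Config) (c : ℂ) :
    polarizationOperator Λ (Finsupp.single n c) = (polarization Λ n : ℂ) • Finsupp.single n c := by
  rw [polarizationOperator, Finsupp.linearCombination_single, Finsupp.smul_single,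
    Finsupp.smul_single, smul_eq_mul, smul_eq_mul, mul_comm]

open Classical in
theorem constraintProjection_single (n : Config) (c : ℂ) :
    constraintProjection (Finsupp.single n c) =
      if IsGroundState n then Finsupp.single n c else 0 := by
  rw [constraintProjection, Finsupp.linearCombination_single]
  split_ifs <;> simp

/-- It suffices to compare on basis vectors. The terms that survive both projections link ground
states differing only within `S`, and these are eigenvectors of the imbalance on `Λ ⊇ S` with the
same eigenvalue. -/
theorem commute_polarizationOperator (S : Finset Site) (X : Matrix (S → Bool) (S → Bool) ℂ)
    (Λ : Finset Site) (h : S ⊆ Λ) :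
    Commute (constraintProjection * localOperator S X * constraintProjection)
      (polarizationOperator Λ) := by
  classical
  refine Finsupp.lhom_ext fun n c => ?_
  simp only [Module.End.mul_apply, polarizationOperator_single, map_smul]
  rw [constraintProjection_single]
  split_ifs with hn
  · rw [localOperator, Finsupp.linearCombination_single]
    simp only [map_smul, map_sum, Finset.smul_sum]
    refine Finset.sum_congr rfl fun m _ => ?_
    rw [constraintProjection_single]
    split_ifs with hm
    · rw [polarizationOperator_single, polarization_eq_of_eq_outside hn hm, smul_comm]
      intro s hs
      rw [patch, dif_neg fun h' => hs (h h')]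
    · simp
  · simp

/-- Ground states of the cluster-charging model as tilings: the boundary invariant determines the
sublattice imbalance, which local operators conserve. -/
theorem mainTheorem1 :
    -- ground states map to tilings of the plane, region by region
    (∀ n : Config, IsGroundState n →
      ∃ 𝒯 : Set (Finset Cell), IsTiling 𝒯 Set.univ ∧
        (∀ s : Site, n s = true → particleTile s ∈ 𝒯) ∧
        (∀ s : Site, ∃ 𝒯' ⊆ 𝒯, IsTiling 𝒯' (siteTile n s)) ∧
        (∀ p : Plaquette, ∃ 𝒯' ⊆ 𝒯, IsTiling 𝒯' (middleRegion n p))) ∧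
    -- a condition on the plaquettes alone under which the tiled region is simply connected
    (∀ R : Finset Plaquette, IsPlaquetteDisc R →
      ∀ n : Config, IsSimplyConnectedRegion (tiledRegion n R)) ∧
    -- the sublattice imbalance of a simply connected region in terms of boundary data
    (∀ n : Config, IsGroundState n →
      (∀ s : Site, HasBoundaryInvariant (siteTile n s) ∧
        HasBoundaryInvariant (particleTile s)) ∧
      ∀ R : Finset Plaquette, IsSimplyConnectedRegion (tiledRegion n R) →
        HasBoundaryInvariant (tiledRegion n R) ∧
        (1 / 2 : ℚ) * (polarization (regionSites R) n : ℚ) =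
          (boundaryInvariant (tiledRegion n R) : ℚ)
          - (2 / 3 : ℚ) * ∑ s ∈ sitesOfDegree R 1,
              ((siteInvariant n s : ℚ) - (1 / 2 : ℚ) * (particleInvariant n s : ℚ))
          - (1 / 3 : ℚ) * ∑ s ∈ sitesOfDegree R 2,
              ((siteInvariant n s : ℚ) - (1 / 2 : ℚ) * (particleInvariant n s : ℚ)) ∧
        ∀ n' : Config, IsGroundState n' →
          (∀ s ∈ sitesOfDegree R 1 ∪ sitesOfDegree R 2, n' s = n s) →
          tiledRegion n' R = tiledRegion n R ∧
          polarization (regionSites R) n' = polarization (regionSites R) n) ∧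
    -- ground states that differ on finitely many sites have the same total imbalance
    (∀ n n' : Config, IsGroundState n → IsGroundState n' →
      ∀ Λ : Finset Site, (∀ s, s ∉ Λ → n' s = n s) → polarization Λ n' = polarization Λ n) ∧
    -- local operators acting within the constrained space conserve the total imbalance
    (∀ (S : Finset Site) (X : Matrix (S → Bool) (S → Bool) ℂ) (Λ : Finset Site), S ⊆ Λ →
      Commute (constraintProjection * localOperator S X * constraintProjection)
        (polarizationOperator Λ)) := by
  exact ⟨fun n hn => exists_tiling hn,
    fun R hR n => hR.isSimplyConnectedRegion n,
    fun n hn => ⟨fun s => ⟨(boundaryInvariant_siteTile hn s).1, (boundaryInvariant_particleTile s).1⟩,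
      fun R hR => ⟨(polarization_eq hn hR).1, (polarization_eq hn hR).2, fun n' hn' h =>
        ⟨tiledRegion_congr h, polarization_congr hn hn' hR h⟩⟩⟩,
    fun n n' hn hn' Λ h => polarization_eq_of_eq_outside hn hn' h,
    commute_polarizationOperator⟩
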